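/- **Conventions.** Let $\mathbb{K}$ be a field of characteristic zero. A (nonsymmetric) operad is a graded vector space $\mathcal{O}=\bigoplus_{n\ge 1}\mathcal{O}(n)$ with a unit $\mathbb{1}\in\mathcal{O}(1)$ and bilinear partial compositions $\circ_i:\mathcal{O}(n)\times\mathcal{O}(m)\to\mathcal{O}(n+m-1)$, $1\le i\le n$, satisfying the usual sequential associativity, parallel associativity and unit axioms. Let $\mathcal{M}$ be a finite unitary magma, that is, a finite set with a binary operation $\star$ having a two-sided unit $1_\mathcal{M}$ (no associativity is assumed). An *$\mathcal{M}$-clique* of arity $n\ge 1$ is a map $\mathfrak{p}$ assigning a label $\mathfrak{p}(x,y)\in\mathcal{M}$ to each arc $(x,y)$, $1\le x<y\le n+1$; for $n=1$ only the label $\mathfrak p(1,2)=1_\mathcal{M}$ is allowed. Write $\mathfrak{p}_0:=\mathfrak{p}(1,n+1)$ (the base) and $\mathfrak{p}_i:=\mathfrak{p}(i,i+1)$ (the $i$th edge); the other arcs are the diagonals. An arc is solid if its label is not $1_\mathcal{M}$, and two diagonals $(x,y)$, $(x',y')$ cross if $x<x'<y<y'$ or $x'<x<y'<y$. The clique $\mathfrak{p}$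 is *noncrossing* if no two solid diagonals of $\mathfrak{p}$ cross. The operad $\mathsf{C}\mathcal{M}$ has the $\mathcal{M}$-cliques of arity $n$ as a basis of its component of arity $n$; for cliques $\mathfrak{p},\mathfrak{q}$ of arities $n,m$, the clique $\mathfrak{p}\circ_i\mathfrak{q}$ of arity $n+m-1$ is obtained by gluing the base of $\mathfrak{q}$ onto the $i$th edge of $\mathfrak{p}$, the arc $(i,i+m)$ resulting from the two glued arcs being labeled by $\mathfrak{p}_i\star\mathfrak{q}_0$, the other arcs of $\mathfrak{p}$ and $\mathfrak{q}$ keeping their labels, and all the remaining arcs being labeled by $1_\mathcal{M}$. Let $\mathrm{NC}\mathcal{M}$ be the suboperad of $\mathsf{C}\mathcal{M}$ spanned by the noncrossing $\mathcal{M}$-cliques. Let $\mathcal{T}_\mathcal{M}$ be the set of all $\mathcal{M}$-triangles, i.e., of all $\mathcal{M}$-cliques of arity $2$, and denote by $(a;b,c)$ the triangle with base $a$, first edge $b$ and second edge $c$. Let $\mathrm{Free}(\mathrm{Vect}(\mathcal{T}_\mathcal{M}))$ be the free operad on $\mathcal{T}_\mathcal{M}$ (in arity $2$): its basis consists of the syntax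 trees, that is, the planar binary trees whose internal nodes are labeled by $\mathcal{T}_\mathcal{M}$, the arity being the number of leaves, and $\circ_i$ grafts a tree on the $i$th leaf. Identify a triangle with the corolla it labels. Let $\mathfrak{R}_{\mathrm{NC}\mathcal{M}}$ be the subspace of $\mathrm{Free}(\mathrm{Vect}(\mathcal{T}_\mathcal{M}))(3)$ spanned by the following elements, for all labels in $\mathcal{M}$: 1. $(p_0;p_1,p_2)\circ_1(q_0;q_1,q_2)-(p_0;r_1,p_2)\circ_1(r_0;q_1,q_2)$ if $p_1\star q_0=r_1\star r_0\ne 1_\mathcal{M}$; 2. $(p_0;p_1,p_2)\circ_1(q_0;q_1,q_2)-(p_0;q_1,r_2)\circ_2(r_0;q_2,p_2)$ if $p_1\star q_0=r_2\star r_0=1_\mathcal{M}$; 3. $(p_0;p_1,p_2)\circ_2(q_0;q_1,q_2)-(p_0;p_1,r_2)\circ_2(r_0;q_1,q_2)$ if $p_2\star q_0=r_2\star r_0\ne 1_\mathcal{M}$. Let $\to$ be the rewrite rule on syntax trees given by - $(p_0;p_1,p_2)\circ_1(q_0;q_1,q_2)\to(p_0;p_1\star q_0,p_2)\circ_1(1_\mathcal{M};q_1,q_2)$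 if $q_0\ne 1_\mathcal{M}$; - $(p_0;p_1,p_2)\circ_1(q_0;q_1,q_2)\to(p_0;q_1,1_\mathcal{M})\circ_2(1_\mathcal{M};q_2,p_2)$ if $p_1\star q_0=1_\mathcal{M}$; - $(p_0;p_1,p_2)\circ_2(q_0;q_1,q_2)\to(p_0;p_1,p_2\star q_0)\circ_2(1_\mathcal{M};q_1,q_2)$ if $q_0\ne 1_\mathcal{M}$. A tree is rewritten in one step by replacing inside it an occurrence of the left member $\mathfrak{s}$ of a rule $\mathfrak{s}\to\mathfrak{s}'$ by $\mathfrak{s}'$. A normal form is a tree that cannot be rewritten; the rule is convergent if there is no infinite chain of one-step rewritings and one-step rewriting is confluent. **Theorem.** Let $\mathcal{M}$ be a finite unitary magma. (a) $\mathrm{NC}\mathcal{M}$ is the suboperad of $\mathsf{C}\mathcal{M}$ generated by the set $\mathcal{T}_\mathcal{M}$ of the $\mathcal{M}$-triangles. (b) $\mathrm{NC}\mathcal{M}$ admits the presentation $(\mathcal{T}_\mathcal{M},\mathfrak{R}_{\mathrm{NC}\mathcal{M}})$, which is binary (the generators have arity $2$) and quadratic (the relations are combinations of trees with two internal nodes):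 there is an operad isomorphism $$\mathrm{Free}(\mathrm{Vect}(\mathcal{T}_\mathcal{M}))/\langle\mathfrak{R}_{\mathrm{NC}\mathcal{M}}\rangle\;\simeq\;\mathrm{NC}\mathcal{M},$$ where $\langle\mathfrak{R}_{\mathrm{NC}\mathcal{M}}\rangle$ is the operad ideal generated by $\mathfrak{R}_{\mathrm{NC}\mathcal{M}}$, sending the class of the corolla labeled by each $\mathcal{M}$-triangle to this triangle. (c) The rewrite rule $\to$ is a convergent orientation of $\mathfrak{R}_{\mathrm{NC}\mathcal{M}}$: the space spanned by the differences $\mathfrak{t}-\mathfrak{t}'$ of syntax trees related by the reflexive, symmetric and transitive closure of $\to$ is $\mathfrak{R}_{\mathrm{NC}\mathcal{M}}$, and $\to$ is convergent. Each space $\mathrm{NC}\mathcal{M}(n)$ is finite-dimensional, there are finitely many normal forms of $\to$ of each arity, and the generating series of the normal forms (by arity) is the Hilbert series $\sum_{n\ge 1}\dim\mathrm{NC}\mathcal{M}(n)\,t^n$ of $\mathrm{NC}\mathcal{M}$. -/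

import Mathlib

universe u v w

/-! ## Nonsymmetric operads

Throughout, an operad is stored with its arities shifted by one: `obj n` is the component of
arity `n + 1`, and `comp i` with `i : Fin (n + 1)` is the partial composition at the input
number `i + 1`. In particular the partial composition of elements of arities `n + 1` and
`m + 1` has arity `(n + 1) + (m + 1) - 1 = (n + m) + 1`. -/

/-- Transport of an element of a graded object along an equality of degrees. -/
def arityCast {O : ℕ → Type u} {a b : ℕ} (h : a = b) (x : O a) : O b := h ▸ x

/-- Nonsymmetric operads in `K`-vector spaces, presented by partial compositions. -/
structure NSOperad (K : Type u) [Field K] where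
  obj : ℕ → Type w
  [addCommGroup : ∀ n, AddCommGroup (obj n)]
  [module : ∀ n, Module K (obj n)]
  one : obj 0
  comp : ∀ {n m : ℕ}, Fin (n + 1) → (obj n →ₗ[K] obj m →ₗ[K] obj (n + m))
  comp_assoc : ∀ {n m k : ℕ} (x : obj n) (y : obj m) (z : obj k) (i : Fin (n + 1))
    (j : Fin (m + 1)),
    arityCast (Nat.add_assoc n m k)
      (comp (⟨i + j, by omega⟩ : Fin (n + m + 1)) (comp i x y) z) = comp i x (comp j y z)
  comp_comm : ∀ {n m k : ℕ} (x : obj n) (y : obj m) (z : obj k) (i j : Fin (n + 1)), i < j →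
    arityCast (Nat.add_right_comm n m k)
      (comp (⟨j + m, by omega⟩ : Fin (n + m + 1)) (comp i x y) z) =
        comp (⟨i, by omega⟩ : Fin (n + k + 1)) (comp j x z) y
  one_comp : ∀ {n : ℕ} (x : obj n), arityCast (Nat.zero_add n) (comp 0 one x) = x
  comp_one : ∀ {n : ℕ} (x : obj n) (i : Fin (n + 1)), comp i x one = x

namespace NSOperad

attribute [instance] NSOperad.addCommGroup NSOperad.module

variable {K : Type u} [Field K]

/-- Operad isomorphisms. -/
structure Iso (O : NSOperad.{u, v} K) (P : NSOperad.{u, w} K) where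
  toEquiv : ∀ n, O.obj n ≃ₗ[K] P.obj n
  map_one : toEquiv 0 O.one = P.one
  map_comp : ∀ {n m : ℕ} (i : Fin (n + 1)) (x : O.obj n) (y : O.obj m),
    toEquiv (n + m) (O.comp i x y) = P.comp i (toEquiv n x) (toEquiv m y)

/-- The Hilbert series `∑_{n ≥ 1} dim O(n) tⁿ`. -/
noncomputable def hilbertSeries (O : NSOperad.{u, w} K) : PowerSeries ℕ :=
  PowerSeries.mk fun n => if n = 0 then 0 else Module.finrank K (O.obj (n - 1))

/-- Suboperads: graded subspaces containing the unit and closed under partial compositions. -/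
@[ext]
structure Suboperad (O : NSOperad.{u, w} K) where
  carrier : ∀ n, Submodule K (O.obj n)
  one_mem : O.one ∈ carrier 0
  comp_mem : ∀ {n m : ℕ} (i : Fin (n + 1)) {x : O.obj n} {y : O.obj m},
    x ∈ carrier n → y ∈ carrier m → O.comp i x y ∈ carrier (n + m)

/-- The suboperad generated by a graded set: the smallest suboperad containing it. -/
def Suboperad.generated (O : NSOperad.{u, w} K) (G : ∀ n, Set (O.obj n)) : O.Suboperad where
  carrier n := ⨅ P : {P : O.Suboperad // ∀ n, G n ⊆ P.carrier n}, P.1.carrier n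
  one_mem := by
    simp only [Submodule.mem_iInf]
    exact fun P => P.1.one_mem
  comp_mem := by
    intro n m i x y hx hy
    simp only [Submodule.mem_iInf] at hx hy ⊢
    exact fun P => P.1.comp_mem i (hx P) (hy P)

theorem arityCast_const {A : Type w} {a b : ℕ} (h : a = b) (x : A) :
    arityCast (O := fun _ => A) h x = x := by
  subst h; rfl

theorem arityCast_subtype {O : ℕ → Type w} (p : ∀ n, O n → Prop) {a b : ℕ} (h : a = b)
    (x : {y : O a // p a y}) :
    (arityCast (O := fun n => {y : O n // p n y}) h x).1 = arityCast h x.1 := by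
  subst h; rfl

/-- A suboperad, seen as an operad. -/
def Suboperad.toOperad {O : NSOperad.{u, w} K} (P : O.Suboperad) : NSOperad.{u, w} K where
  obj n := P.carrier n
  one := ⟨O.one, P.one_mem⟩
  comp {n m} i := LinearMap.mk₂ K
    (fun x y => (⟨O.comp i x.1 y.1, P.comp_mem i x.2 y.2⟩ : P.carrier (n + m)))
    (fun _ _ _ => Subtype.ext (by simp)) (fun _ _ _ => Subtype.ext (by simp))
    (fun _ _ _ => Subtype.ext (by simp)) (fun _ _ _ => Subtype.ext (by simp))
  comp_assoc x y z i j := Subtype.ext <|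
    (arityCast_subtype (fun n y => y ∈ P.carrier n) _ _).trans (O.comp_assoc x.1 y.1 z.1 i j)
  comp_comm x y z i j h := Subtype.ext <|
    (arityCast_subtype (fun n y => y ∈ P.carrier n) _ _).trans (O.comp_comm x.1 y.1 z.1 i j h)
  one_comp x := Subtype.ext <|
    (arityCast_subtype (fun n y => y ∈ P.carrier n) _ _).trans (O.one_comp x.1)
  comp_one x i := Subtype.ext (O.comp_one x.1 i)

/-- Operad ideals. -/
@[ext]
structure OperadIdeal (O : NSOperad.{u, w} K) where
  carrier : ∀ n, Submodule K (O.obj n)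
  comp_mem_left : ∀ {n m : ℕ} (i : Fin (n + 1)) (x : O.obj n) {y : O.obj m},
    y ∈ carrier m → O.comp i x y ∈ carrier (n + m)
  comp_mem_right : ∀ {n m : ℕ} (i : Fin (n + 1)) {x : O.obj n} (y : O.obj m),
    x ∈ carrier n → O.comp i x y ∈ carrier (n + m)

/-- The operad ideal generated by a graded subspace: the smallest ideal containing it. -/
def OperadIdeal.generated (O : NSOperad.{u, w} K) (R : ∀ n, Submodule K (O.obj n)) :
    O.OperadIdeal where
  carrier n := ⨅ I : {I : O.OperadIdeal // ∀ n, R n ≤ I.carrier n}, I.1.carrier n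
  comp_mem_left := by
    intro n m i x y hy
    simp only [Submodule.mem_iInf] at hy ⊢
    exact fun I => I.1.comp_mem_left i x (hy I)
  comp_mem_right := by
    intro n m i x y hx
    simp only [Submodule.mem_iInf] at hx ⊢
    exact fun I => I.1.comp_mem_right i y (hx I)

theorem arityCast_mk {O : NSOperad.{u, w} K} (I : O.OperadIdeal) {a b : ℕ} (h : a = b)
    (x : O.obj a) :
    arityCast (O := fun n => O.obj n ⧸ I.carrier n) h (Submodule.Quotient.mk x) =
      Submodule.Quotient.mk (arityCast h x) := by
  subst h; rfl

/-- The partial composition of a quotient operad. -/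
def OperadIdeal.quotientComp {O : NSOperad.{u, w} K} (I : O.OperadIdeal) {n m : ℕ}
    (i : Fin (n + 1)) : (O.obj n ⧸ I.carrier n) →ₗ[K] (O.obj m ⧸ I.carrier m) →ₗ[K]
      (O.obj (n + m) ⧸ I.carrier (n + m)) :=
  (I.carrier n).liftQ
    { toFun := fun x => (I.carrier m).mapQ (I.carrier (n + m)) (O.comp i x)
        fun _ hy => I.comp_mem_left i x hy
      map_add' := fun x x' => by
        apply Submodule.linearMap_qext
        ext y
        simp
      map_smul' := fun c x => by
        apply Submodule.linearMap_qext
        ext y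
        simp }
    (fun x hx => by
      rw [LinearMap.mem_ker]
      apply Submodule.linearMap_qext
      ext y
      simpa using I.comp_mem_right i y hx)

/-- The quotient operad `O / I`. -/
def OperadIdeal.quotient {O : NSOperad.{u, w} K} (I : O.OperadIdeal) : NSOperad.{u, w} K where
  obj n := O.obj n ⧸ I.carrier n
  one := Submodule.Quotient.mk O.one
  comp i := I.quotientComp i
  comp_assoc x y z i j := by
    induction x using Submodule.Quotient.induction_on with | _ x
    induction y using Submodule.Quotient.induction_on with | _ y
    induction z using Submodule.Quotient.induction_on with | _ z
    refine (arityCast_mk I _ _).trans ?_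
    rw [O.comp_assoc]
    rfl
  comp_comm x y z i j h := by
    induction x using Submodule.Quotient.induction_on with | _ x
    induction y using Submodule.Quotient.induction_on with | _ y
    induction z using Submodule.Quotient.induction_on with | _ z
    refine (arityCast_mk I _ _).trans ?_
    rw [O.comp_comm _ _ _ _ _ h]
    rfl
  one_comp x := by
    induction x using Submodule.Quotient.induction_on with | _ x
    refine (arityCast_mk I _ _).trans ?_
    rw [O.one_comp]
  comp_one x i := by
    induction x using Submodule.Quotient.induction_on with | _ x
    exact congrArg _ (O.comp_one x i)

/-- The canonical projection onto the quotient operad. -/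
def OperadIdeal.proj {O : NSOperad.{u, w} K} (I : O.OperadIdeal) (n : ℕ) :
    O.obj n →ₗ[K] I.quotient.obj n :=
  (I.carrier n).mkQ

end NSOperad

/-- Nonsymmetric operads in sets, with the same conventions on arities. -/
structure SetOperad where
  obj : ℕ → Type v
  one : obj 0
  comp : ∀ {n m : ℕ}, Fin (n + 1) → obj n → obj m → obj (n + m)
  comp_assoc : ∀ {n m k : ℕ} (x : obj n) (y : obj m) (z : obj k) (i : Fin (n + 1))
    (j : Fin (m + 1)),
    arityCast (Nat.add_assoc n m k)
      (comp (⟨i + j, by omega⟩ : Fin (n + m + 1)) (comp i x y) z) = comp i x (comp j y z)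
  comp_comm : ∀ {n m k : ℕ} (x : obj n) (y : obj m) (z : obj k) (i j : Fin (n + 1)), i < j →
    arityCast (Nat.add_right_comm n m k)
      (comp (⟨j + m, by omega⟩ : Fin (n + m + 1)) (comp i x y) z) =
        comp (⟨i, by omega⟩ : Fin (n + k + 1)) (comp j x z) y
  one_comp : ∀ {n : ℕ} (x : obj n), arityCast (Nat.zero_add n) (comp 0 one x) = x
  comp_one : ∀ {n : ℕ} (x : obj n) (i : Fin (n + 1)), comp i x one = x

namespace SetOperad

variable (K : Type u) [Field K]

/-- The bilinear extension of the partial composition. -/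
noncomputable def linComp (S : SetOperad.{v}) {n m : ℕ} (i : Fin (n + 1)) :
    (S.obj n →₀ K) →ₗ[K] (S.obj m →₀ K) →ₗ[K] (S.obj (n + m) →₀ K) :=
  Finsupp.linearCombination K fun x => Finsupp.lmapDomain K K (S.comp i x)

theorem linComp_single (S : SetOperad.{v}) {n m : ℕ} (i : Fin (n + 1)) (x : S.obj n)
    (y : S.obj m) (a b : K) :
    S.linComp K i (Finsupp.single x a) (Finsupp.single y b) =
      Finsupp.single (S.comp i x y) (a * b) := by
  simp [linComp, Finsupp.mapDomain_single]

/-- `arityCast` as a linear map, on the linear span of a graded set. -/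
noncomputable def linCast (S : SetOperad.{v}) {a b : ℕ} (h : a = b) :
    (S.obj a →₀ K) →ₗ[K] (S.obj b →₀ K) :=
  Finsupp.lmapDomain K K (arityCast h)

theorem arityCast_eq_linCast (S : SetOperad.{v}) {a b : ℕ} (h : a = b) (x : S.obj a →₀ K) :
    arityCast (O := fun n => S.obj n →₀ K) h x = S.linCast K h x := by
  subst h
  exact (Finsupp.mapDomain_id (v := x)).symm

theorem linCast_single (S : SetOperad.{v}) {a b : ℕ} (h : a = b) (x : S.obj a) (c : K) :
    S.linCast K h (Finsupp.single x c) = Finsupp.single (arityCast h x) c := by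
  simp [linCast, Finsupp.mapDomain_single]

/-- The linear span of a set-operad: `obj n` has the set `S.obj n` as a basis, and the partial
compositions are extended bilinearly. -/
noncomputable def linear (S : SetOperad.{v}) : NSOperad.{u, max u v} K where
  obj n := S.obj n →₀ K
  one := Finsupp.single S.one 1
  comp i := S.linComp K i
  comp_assoc x y z i j := by
    refine (S.arityCast_eq_linCast K _ _).trans ?_
    induction x using Finsupp.induction_linear with
    | zero => simp
    | add x x' hx hx' => simp only [map_add, LinearMap.add_apply, hx, hx']
    | single x a =>
    induction y using Finsupp.induction_linear with
    | zero => simp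
    | add y y' hy hy' => simp only [map_add, LinearMap.add_apply, hy, hy']
    | single y b =>
    induction z using Finsupp.induction_linear with
    | zero => simp
    | add z z' hz hz' => simp only [map_add, hz, hz']
    | single z c => simp only [linComp_single, linCast_single, S.comp_assoc, mul_assoc]
  comp_comm x y z i j h := by
    refine (S.arityCast_eq_linCast K _ _).trans ?_
    induction x using Finsupp.induction_linear with
    | zero => simp
    | add x x' hx hx' => simp only [map_add, LinearMap.add_apply, hx, hx']
    | single x a =>
    induction y using Finsupp.induction_linear with
    | zero => simp
    | add y y' hy hy' => simp only [map_add, LinearMap.add_apply, hy, hy']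
    | single y b =>
    induction z using Finsupp.induction_linear with
    | zero => simp
    | add z z' hz hz' => simp only [map_add, LinearMap.add_apply, hz, hz']
    | single z c =>
      simp only [linComp_single, linCast_single, S.comp_comm _ _ _ _ _ h, mul_right_comm]
  one_comp x := by
    refine (S.arityCast_eq_linCast K _ _).trans ?_
    induction x using Finsupp.induction_linear with
    | zero => simp
    | add x x' hx hx' => simp only [map_add, hx, hx']
    | single x a => simp only [linComp_single, linCast_single, S.one_comp, one_mul]
  comp_one x i := by
    induction x using Finsupp.induction_linear with
    | zero => simp
    | add x x' hx hx' => simp only [map_add, LinearMap.add_apply, hx, hx']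
    | single x a => simpa using (S.linComp_single K i x S.one a 1).trans (by simp [S.comp_one])

/-- The basis element of the linear span indexed by `x`. -/
noncomputable def basis (S : SetOperad.{v}) {n : ℕ} (x : S.obj n) : (S.linear K).obj n :=
  Finsupp.single x (1 : K)

end SetOperad

/-! ## Cliques decorated by a unitary magma

A unitary magma is a type `M` with `MulOneClass M`. Cliques follow the shifted convention:
`Clique M n` consists of the `M`-cliques of size (arity) `n + 1`, on the vertices
`1, …, n + 2`. -/

/-- The arcs of the clique of size `n + 1`. -/
def Arc (n : ℕ) : Type := {a : ℕ × ℕ // 1 ≤ a.1 ∧ a.1 < a.2 ∧ a.2 ≤ n + 2}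

/-- The `M`-cliques of size `n + 1`. The only one of size `1` has its base labeled by `1`. -/
@[ext]
structure Clique (M : Type v) [MulOneClass M] (n : ℕ) where
  label : Arc n → M
  label_of_size_one : n = 0 → ∀ a, label a = 1

namespace Clique

variable {M : Type v} [MulOneClass M] {n m k : ℕ}

/-- The label of the arc `(x, y)`; by convention `1` if `(x, y)` is not an arc. -/
def lab (p : Clique M n) (x y : ℕ) : M :=
  if h : 1 ≤ x ∧ x < y ∧ y ≤ n + 2 then p.label ⟨(x, y), h⟩ else 1

/-- The label of the arc `(x, y)` in the partial composition of `p` (of size `n + 1`) and `q`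
(of size `m + 1`), where the base of `q` is glued onto the `i`th edge of `p`, `1 ≤ i ≤ n + 1`. -/
def compLab (p : Clique M n) (i : ℕ) (q : Clique M m) (x y : ℕ) : M :=
  if y ≤ i then p.lab x y
  else if (x ≤ i ∧ i + (m + 1) ≤ y) ∧ ¬(x = i ∧ y = i + (m + 1)) then p.lab x (y - (m + 1) + 1)
  else if i + (m + 1) ≤ x then p.lab (x - (m + 1) + 1) (y - (m + 1) + 1)
  else if (i ≤ x ∧ x < y ∧ y ≤ i + (m + 1)) ∧ ¬(x = i ∧ y = i + (m + 1)) then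
    q.lab (x - i + 1) (y - i + 1)
  else if x = i ∧ y = i + (m + 1) then p.lab i (i + 1) * q.lab 1 (m + 2)
  else 1

theorem lab_size_one (p : Clique M 0) (x y : ℕ) : p.lab x y = 1 := by
  unfold lab; split_ifs
  · exact p.label_of_size_one rfl _
  · rfl

theorem lab_outside (p : Clique M n) {x y : ℕ} (h : ¬(1 ≤ x ∧ x < y ∧ y ≤ n + 2)) :
    p.lab x y = 1 := dif_neg h

theorem ext_lab {p q : Clique M n}
    (h : ∀ x y, 1 ≤ x → x < y → y ≤ n + 2 → p.lab x y = q.lab x y) : p = q := by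
  ext ⟨⟨x, y⟩, hxy⟩
  have := h x y hxy.1 hxy.2.1 hxy.2.2
  simpa [lab, dif_pos hxy] using this

/-- The partial composition of `M`-cliques. -/
def comp (i : Fin (n + 1)) (p : Clique M n) (q : Clique M m) : Clique M (n + m) where
  label a := compLab p (i + 1) q a.1.1 a.1.2
  label_of_size_one h a := by
    obtain ⟨rfl, rfl⟩ : n = 0 ∧ m = 0 := by omega
    simp [compLab, lab_size_one]

theorem lab_comp (i : Fin (n + 1)) (p : Clique M n) (q : Clique M m) (x y : ℕ)
    (h : 1 ≤ x ∧ x < y ∧ y ≤ n + m + 2) :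
    (comp i p q).lab x y = compLab p (i + 1) q x y := by
  rw [lab, dif_pos h]; rfl

theorem lab_arityCast {a b : ℕ} (h : a = b) (p : Clique M a) (x y : ℕ) :
    (arityCast h p : Clique M b).lab x y = p.lab x y := by
  subst h; rfl

/-- The `M`-clique of size `1`. -/
def one : Clique M 0 := ⟨fun _ => 1, fun _ _ => rfl⟩

theorem compLab_comp_left (i : Fin (n + 1)) (j : ℕ) (p : Clique M n) (q : Clique M m) (r : Clique M k)
    {x y : ℕ} (h1 : 1 ≤ x) (h2 : x < y) (h3 : y ≤ n + m + k + 2) (hj : 1 ≤ j) (hj' : j ≤ n + m + 1) :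
    compLab (comp i p q) j r x y = 
      if y ≤ j then compLab p (i+1) q x y
      else if (x ≤ j ∧ j + (k + 1) ≤ y) ∧ ¬(x = j ∧ y = j + (k + 1)) then compLab p (i+1) q x (y - k)
      else if j + (k + 1) ≤ x then compLab p (i+1) q (x - k) (y - k)
      else if (j ≤ x ∧ x < y ∧ y ≤ j + (k + 1)) ∧ ¬(x = j ∧ y = j + (k + 1)) then
        r.lab (x - j + 1) (y - j + 1)
      else if x = j ∧ y = j + (k + 1) then compLab p (i+1) q j (j + 1) * r.lab 1 (k + 2)
      else 1 := by
  rw [compLab]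
  split_ifs
  · rw [lab_comp _ _ _ _ _ (by omega)]
  · rw [lab_comp _ _ _ _ _ (by omega)]; congr 1; omega
  · rw [lab_comp _ _ _ _ _ (by omega)]; congr 1 <;> omega
  · rfl
  · rw [lab_comp _ _ _ _ _ (by omega)]
  · rfl


theorem compLab_comp_right (i : ℕ) (j : Fin (m + 1)) (p : Clique M n) (q : Clique M m) (r : Clique M k)
    {x y : ℕ} (h2 : x < y) :
    compLab p i (comp j q r) x y = 
      if y ≤ i then p.lab x y
      else if (x ≤ i ∧ i + (m + k + 1) ≤ y) ∧ ¬(x = i ∧ y = i + (m + k + 1)) then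
        p.lab x (y - (m + k))
      else if i + (m + k + 1) ≤ x then p.lab (x - (m + k)) (y - (m + k))
      else if (i ≤ x ∧ x < y ∧ y ≤ i + (m + k + 1)) ∧ ¬(x = i ∧ y = i + (m + k + 1)) then
        compLab q (j + 1) r (x - i + 1) (y - i + 1)
      else if x = i ∧ y = i + (m + k + 1) then
        p.lab i (i + 1) * compLab q (j + 1) r 1 (m + k + 2)
      else 1 := by
  rw [compLab]
  split_ifs
  · rfl
  · congr 1; omega
  · congr 1 <;> omega
  · rw [lab_comp _ _ _ _ _ (by omega)]
  · rw [lab_comp _ _ _ _ _ (by omega)]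
  · rfl

set_option maxHeartbeats 4000000 in
theorem comp_assoc (p : Clique M n) (q : Clique M m) (r : Clique M k) (i : Fin (n + 1))
    (j : Fin (m + 1)) :
    arityCast (Nat.add_assoc n m k) (comp ⟨i + j, by omega⟩ (comp i p q) r) =
      comp i p (comp j q r) := by
  apply ext_lab
  intro x y h1 h2 h3
  rw [lab_arityCast, lab_comp _ _ _ _ _ (by omega), lab_comp _ _ _ _ _ (by omega),
    compLab_comp_left _ _ _ _ _ h1 h2 (by omega) (by simp) (by simp; omega), compLab_comp_right _ _ _ _ _ h2]
  obtain ⟨i, hi⟩ := i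
  obtain ⟨j, hj⟩ := j
  dsimp only
  rcases Nat.eq_zero_or_pos m with rfl | hm
  · obtain rfl : j = 0 := by omega
    simp only [compLab, lab_size_one q, mul_one, one_mul]
    grind (splits := 40)
  · unfold compLab
    grind (splits := 40)

set_option maxHeartbeats 4000000 in
theorem comp_comm (p : Clique M n) (q : Clique M m) (r : Clique M k) (i j : Fin (n + 1))
    (hij : i < j) :
    arityCast (Nat.add_right_comm n m k) (comp ⟨j + m, by omega⟩ (comp i p q) r) =
      comp ⟨i, by omega⟩ (comp j p r) q := by
  apply ext_lab
  intro x y h1 h2 h3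
  rw [lab_arityCast, lab_comp _ _ _ _ _ (by omega), lab_comp _ _ _ _ _ (by omega),
    compLab_comp_left _ _ _ _ _ h1 h2 (by omega) (by simp) (by simp; omega),
    compLab_comp_left _ _ _ _ _ h1 h2 (by omega) (by simp) (by simp; omega)]
  obtain ⟨i, hi⟩ := i
  obtain ⟨j, hj⟩ := j
  simp only [Fin.mk_lt_mk] at hij
  dsimp only
  unfold compLab
  grind (splits := 40)

theorem one_comp (p : Clique M n) : arityCast (Nat.zero_add n) (comp 0 one p) = p := by
  apply ext_lab
  intro x y h1 h2 h3
  rw [lab_arityCast, lab_comp _ _ _ _ _ (by omega)]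
  simp only [compLab, lab_size_one, one_mul, Fin.val_zero]
  grind

theorem comp_one (p : Clique M n) (i : Fin (n + 1)) : comp i p one = p := by
  apply ext_lab
  intro x y h1 h2 h3
  rw [lab_comp _ _ _ _ _ (by omega)]
  simp only [compLab, lab_size_one, mul_one]
  grind

/-- `(x, y)` is a diagonal of the clique of size `n + 1`: an arc which is neither an edge
`(x, x + 1)` nor the base `(1, n + 2)`. -/
def IsDiagonal (n x y : ℕ) : Prop :=
  1 ≤ x ∧ x < y ∧ y ≤ n + 2 ∧ y ≠ x + 1 ∧ ¬(x = 1 ∧ y = n + 2)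

def Crossing (x y x' y' : ℕ) : Prop :=
  (x < x' ∧ x' < y ∧ y < y') ∨ (x' < x ∧ x < y' ∧ y' < y)

/-- A clique is noncrossing if no two of its solid diagonals (those whose label is not the unit)
are crossing. -/
def Noncrossing (p : Clique M n) : Prop :=
  ∀ x y x' y', IsDiagonal n x y → IsDiagonal n x' y' → p.lab x y ≠ 1 → p.lab x' y' ≠ 1 →
    ¬ Crossing x y x' y'

theorem Noncrossing.wlog {p : Clique M n} (hp : ∀ x y x' y', x < x' → x' < y → y < y' → p.lab x y ≠ 1 → p.lab x' y' ≠ 1 → False) : p.Noncrossing := by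
  rintro x y x' y' - - h1 h2 (h | h)
  · exact hp x y x' y' h.1 h.2.1 h.2.2 h1 h2
  · exact hp x' y' x y h.1 h.2.1 h.2.2 h2 h1

theorem Noncrossing.elim {p : Clique M n} (hp : p.Noncrossing) {x y x' y' : ℕ} (h1 : x < x')
    (h2 : x' < y) (h3 : y < y') (h : p.lab x y ≠ 1) : p.lab x' y' = 1 := by
  by_contra h'
  have a : 1 ≤ x ∧ x < y ∧ y ≤ n + 2 := by by_contra hc; exact h (p.lab_outside hc)
  have b : 1 ≤ x' ∧ x' < y' ∧ y' ≤ n + 2 := by by_contra hc; exact h' (p.lab_outside hc)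
  refine hp x y x' y' ?_ ?_ h h' (Or.inl ⟨h1, h2, h3⟩) <;> unfold IsDiagonal <;> omega

set_option maxHeartbeats 4000000 in
theorem Noncrossing.comp {p : Clique M n} {q : Clique M m} (hp : p.Noncrossing)
    (hq : q.Noncrossing) (i : Fin (n + 1)) : (comp i p q).Noncrossing := by
  apply Noncrossing.wlog
  intro x y x' y' h1 h2 h3 h h'
  have a : 1 ≤ x ∧ x < y ∧ y ≤ n + m + 2 := by by_contra hc; exact h (lab_outside _ hc)
  have b : 1 ≤ x' ∧ x' < y' ∧ y' ≤ n + m + 2 := by by_contra hc; exact h' (lab_outside _ hc)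
  rw [lab_comp _ _ _ _ _ a, compLab] at h
  rw [lab_comp _ _ _ _ _ b, compLab] at h'
  have hp' := @Noncrossing.elim _ _ _ p hp
  have hq' := @Noncrossing.elim _ _ _ q hq
  split_ifs at h h' <;> first
    | omega
    | exact h rfl
    | exact h' rfl
    | exact h' (hp' (by omega) (by omega) (by omega) h)
    | exact h' (hq' (by omega) (by omega) (by omega) h)

theorem noncrossing_of_size_le_two (p : Clique M n) (hn : n ≤ 1) : p.Noncrossing := by
  intro x y x' y' h
  unfold IsDiagonal at h
  omega

/-- The set-operad of all `M`-cliques. -/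
def setOperad (M : Type v) [MulOneClass M] : SetOperad.{v} where
  obj n := Clique M n
  one := one
  comp i p q := comp i p q
  comp_assoc := comp_assoc
  comp_comm := comp_comm
  one_comp := one_comp
  comp_one := comp_one

end Clique

/-- The `M`-triangles, that is, the `M`-cliques of size `2`. -/
abbrev Triangle (M : Type v) [MulOneClass M] : Type v := Clique M 1

/-- The `M`-triangle with base `(1, 3)` labeled by `a`, first edge `(1, 2)` labeled by `b`, and
second edge `(2, 3)` labeled by `c`. -/
def Triangle.mk {M : Type v} [MulOneClass M] (a b c : M) : Triangle M where
  label e := if e.1 = (1, 3) then a else if e.1 = (1, 2) then b else c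
  label_of_size_one h := absurd h one_ne_zero

section CliqueOperads

variable (K : Type u) [Field K] (M : Type v) [MulOneClass M]

/-- The `M`-clique operad `C M`. -/
noncomputable def cliqueOperad : NSOperad.{u, max u v} K := (Clique.setOperad M).linear K

variable {M} in
/-- An `M`-clique as an element of the fundamental basis of `C M`. -/
noncomputable def cliqueBasis {n : ℕ} (p : Clique M n) : (cliqueOperad K M).obj n :=
  (Clique.setOperad M).basis K p

/-- The `M`-triangles, as a graded subset of `C M` (concentrated in arity `2`). -/
def triangleSet (n : ℕ) : Set ((cliqueOperad K M).obj n) :=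
  {x | n = 1 ∧ ∃ p : Clique M n, x = cliqueBasis K p}

/-- The suboperad `NC M` of `C M`: the linear span of all noncrossing `M`-cliques. -/
noncomputable def ncSuboperad : (cliqueOperad K M).Suboperad where
  carrier n := Submodule.span K {x | ∃ p : Clique M n, p.Noncrossing ∧ x = cliqueBasis K p}
  one_mem := Submodule.subset_span
    ⟨Clique.one, Clique.noncrossing_of_size_le_two _ (Nat.zero_le 1), rfl⟩
  comp_mem {n m} i x y hx hy := by
    have := Submodule.apply_mem_map₂ ((cliqueOperad K M).comp i) hx hy
    rw [Submodule.map₂_span_span] at this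
    refine Submodule.span_mono ?_ this
    rintro _ ⟨_, ⟨p, hp, rfl⟩, _, ⟨q, hq, rfl⟩, rfl⟩
    refine ⟨Clique.comp i p q, hp.comp hq i, ?_⟩
    exact ((Clique.setOperad M).linComp_single K i p q 1 1).trans (by rw [mul_one]; rfl)

/-- The noncrossing `M`-clique operad `NC M`. -/
noncomputable def ncOperad : NSOperad.{u, max u v} K := (ncSuboperad K M).toOperad

variable {M} in
/-- An `M`-triangle as an element of `NC M`. -/
noncomputable def ncTriangle (p : Triangle M) : (ncOperad K M).obj 1 :=
  (⟨cliqueBasis K p, Submodule.subset_span ⟨p, p.noncrossing_of_size_le_two le_rfl, rfl⟩⟩ :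
    (ncSuboperad K M).carrier 1)

end CliqueOperads

/-! ## Syntax trees on binary generators and free operads

A syntax tree on a set `G` of generators, all of arity `2`, is a binary tree whose internal nodes
are labeled by `G`, that is, an element of `BinaryTree G`. Its arity is its number of leaves and
its degree is its number of internal nodes. Leaves are numbered from `0` from left to right. -/

namespace SyntaxTree

variable {G : Type v}

/-- Grafting of the root of `s` on the leaf number `i` of a tree. -/
def graft : BinaryTree G → ℕ → BinaryTree G → BinaryTree G
  | .nil, _, s => s
  | .node g l r, i, s =>
    if i < l.numLeaves then .node g (graft l i s) r else .node g l (graft r (i - l.numLeaves) s)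

/-- Simultaneous grafting of `f j` on the leaf number `j`, for all leaves of a tree. -/
def graftAll : BinaryTree G → (ℕ → BinaryTree G) → BinaryTree G
  | .nil, f => f 0
  | .node g l r, f => .node g (graftAll l f) (graftAll r fun j => f (l.numLeaves + j))

/-- The tree with a single internal node, labeled by `g`. -/
def corolla (g : G) : BinaryTree G := .node g .nil .nil

theorem numLeaves_pos (t : BinaryTree G) : 0 < t.numLeaves := by
  rw [BinaryTree.numLeaves_eq_numNodes_succ]; omega

theorem numLeaves_graft (t s : BinaryTree G) (i : ℕ) (h : i < t.numLeaves) :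
    (graft t i s).numLeaves + 1 = t.numLeaves + s.numLeaves := by
  induction t generalizing i with
  | nil => simp [graft, add_comm]
  | node g l r hl hr =>
    simp only [BinaryTree.numLeaves] at h
    rw [graft]
    split_ifs with h'
    · have := hl i h'
      simp only [BinaryTree.numLeaves]; omega
    · have := hr (i - l.numLeaves) (by omega)
      simp only [BinaryTree.numLeaves]; omega

theorem graft_graft_assoc (t s r : BinaryTree G) (i j : ℕ) (hi : i < t.numLeaves)
    (hj : j < s.numLeaves) : graft (graft t i s) (i + j) r = graft t i (graft s j r) := by
  induction t generalizing i with
  | nil =>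
    obtain rfl : i = 0 := by simpa using hi
    simp [graft]
  | node g a b ha hb =>
    simp only [BinaryTree.numLeaves] at hi
    by_cases h : i < a.numLeaves
    · have h1 := numLeaves_graft a s i h
      simp only [graft, if_pos h]
      rw [if_pos (by omega), ha i h]
    · simp only [graft, if_neg h]
      rw [if_neg (by omega), show i + j - a.numLeaves = (i - a.numLeaves) + j by omega,
        hb (i - a.numLeaves) (by omega)]

theorem graft_graft_comm (t s r : BinaryTree G) (i j : ℕ) (hij : i < j) (hj : j < t.numLeaves) :
    graft (graft t i s) (j + s.numLeaves - 1) r = graft (graft t j r) i s := by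
  have hs := numLeaves_pos s
  induction t generalizing i j with
  | nil =>
    simp only [BinaryTree.numLeaves] at hj
    omega
  | node g a b ha hb =>
    simp only [BinaryTree.numLeaves] at hj
    by_cases h : j < a.numLeaves
    · have h1 := numLeaves_graft a s i (by omega)
      have h2 := numLeaves_graft a r j (by omega)
      have h3 := numLeaves_pos r
      simp only [graft, if_pos h, if_pos (hij.trans h)]
      rw [if_pos (by omega), if_pos (by omega), ha i j hij h]
    · by_cases h' : i < a.numLeaves
      · have h1 := numLeaves_graft a s i (by omega)
        simp only [graft, if_pos h', if_neg h]
        rw [if_neg (by omega)]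
        congr 2
        omega
      · simp only [graft, if_neg h', if_neg h]
        rw [if_neg (by omega), ← hb (i - a.numLeaves) (j - a.numLeaves) (by omega) (by omega)]
        congr 2
        omega

theorem graft_nil (t : BinaryTree G) (i : ℕ) : graft t i .nil = t := by
  induction t generalizing i with
  | nil => rfl
  | node g a b ha hb => rw [graft]; split_ifs <;> simp [ha, hb]

end SyntaxTree

/-- The syntax trees on `G` of arity `n + 1`. -/
def SynTree (G : Type v) (n : ℕ) : Type v := {t : BinaryTree G // t.numLeaves = n + 1}

/-- The set-operad of the syntax trees on `G`. -/
def SynTree.setOperad (G : Type v) : SetOperad.{v} where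
  obj n := SynTree G n
  one := ⟨.nil, rfl⟩
  comp {n m} i t s := ⟨SyntaxTree.graft t.1 i s.1, by
    have := SyntaxTree.numLeaves_graft t.1 s.1 i (by rw [t.2]; exact i.2)
    rw [t.2, s.2] at this
    omega⟩
  comp_assoc x y z i j := Subtype.ext <|
    (NSOperad.arityCast_subtype (fun n (t : BinaryTree G) => t.numLeaves = n + 1) _ _).trans <| by
      rw [NSOperad.arityCast_const]
      exact SyntaxTree.graft_graft_assoc _ _ _ _ _ (by rw [x.2]; exact i.2) (by rw [y.2]; exact j.2)
  comp_comm {n m k} x y z i j h := Subtype.ext <|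
    (NSOperad.arityCast_subtype (fun n (t : BinaryTree G) => t.numLeaves = n + 1) _ _).trans <| by
      rw [NSOperad.arityCast_const]
      have := SyntaxTree.graft_graft_comm x.1 y.1 z.1 i j h (by rw [x.2]; exact j.2)
      rw [y.2] at this
      exact this
  one_comp x := Subtype.ext <|
    (NSOperad.arityCast_subtype (fun n (t : BinaryTree G) => t.numLeaves = n + 1) _ _).trans <| by
      rw [NSOperad.arityCast_const]
      rfl
  comp_one x i := Subtype.ext (SyntaxTree.graft_nil _ _)

/-- The free operad `Free(Vect(G))` on a set `G` of generators of arity `2`: its component of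
arity `n + 1` has the syntax trees on `G` of arity `n + 1` as a basis. -/
noncomputable def freeOperad (K : Type u) [Field K] (G : Type v) : NSOperad.{u, max u v} K :=
  (SynTree.setOperad G).linear K

/-- A syntax tree as an element of the free operad. -/
noncomputable def treeBasis (K : Type u) [Field K] {G : Type v} {n : ℕ} (t : SynTree G n) :
    (freeOperad K G).obj n :=
  (SynTree.setOperad G).basis K t

/-- The corolla labeled by `g`, in the free operad. -/
noncomputable def freeCorolla (K : Type u) [Field K] {G : Type v} (g : G) :
    (freeOperad K G).obj 1 :=
  treeBasis K ⟨SyntaxTree.corolla g, rfl⟩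

/-- A graded subspace of the free operad is quadratic if it consists of linear combinations of
syntax trees of degree `2`. -/
def IsQuadratic {K : Type u} [Field K] {G : Type v}
    (R : ∀ n, Submodule K ((freeOperad K G).obj n)) : Prop :=
  ∀ n, R n ≤ Submodule.span K {x | ∃ t : SynTree G n, t.1.numNodes = 2 ∧ x = treeBasis K t}

/-! ## Rewrite rules on syntax trees -/

namespace RewriteRule

variable {G : Type v}

/-- `t` is rewritable in one step into `t'`: it is obtained by replacing in `t` an occurrence of a
pattern `s` by `s'`, where `s → s'`. Such an occurrence has a part `u` of `t` above it and the
trees `f 0, f 1, …` grafted on its leaves. -/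
def Step (rule : BinaryTree G → BinaryTree G → Prop) (t t' : BinaryTree G) : Prop :=
  ∃ (u : BinaryTree G) (i : ℕ) (s s' : BinaryTree G) (f : ℕ → BinaryTree G),
    i < u.numLeaves ∧ rule s s' ∧ t = SyntaxTree.graft u i (SyntaxTree.graftAll s f) ∧
      t' = SyntaxTree.graft u i (SyntaxTree.graftAll s' f)

def Terminating (rule : BinaryTree G → BinaryTree G → Prop) : Prop :=
  ¬ ∃ t : ℕ → BinaryTree G, ∀ j, Step rule (t j) (t (j + 1))

def Confluent (rule : BinaryTree G → BinaryTree G → Prop) : Prop :=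
  ∀ t r₁ r₂, Relation.ReflTransGen (Step rule) t r₁ → Relation.ReflTransGen (Step rule) t r₂ →
    ∃ t', Relation.ReflTransGen (Step rule) r₁ t' ∧ Relation.ReflTransGen (Step rule) r₂ t'

def Convergent (rule : BinaryTree G → BinaryTree G → Prop) : Prop :=
  Terminating rule ∧ Confluent rule

def IsNormalForm (rule : BinaryTree G → BinaryTree G → Prop) (t : BinaryTree G) : Prop :=
  ∀ t', ¬ Step rule t t'

/-- The generating series of the normal forms, enumerated by their arities. -/
noncomputable def normalFormSeries (rule : BinaryTree G → BinaryTree G → Prop) : PowerSeries ℕ :=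
  PowerSeries.mk fun n => Nat.card {t : BinaryTree G // t.numLeaves = n ∧ IsNormalForm rule t}

/-- The (graded) space induced by a rewrite rule: it is spanned by the differences of two trees
related by the reflexive, symmetric and transitive closure of the rule. -/
noncomputable def inducedSpace (K : Type u) [Field K] (rule : BinaryTree G → BinaryTree G → Prop) (n : ℕ) :
    Submodule K ((freeOperad K G).obj n) :=
  Submodule.span K {x | ∃ t t' : SynTree G n, Relation.EqvGen rule t.1 t'.1 ∧
    x = treeBasis K t - treeBasis K t'}

end RewriteRule

/-! ## The relations between triangles and their orientation -/

section NCPresentation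

variable (K : Type u) [Field K] (M : Type v) [MulOneClass M]

/-- The corolla `c(△)` labeled by the triangle with base `a` and edges `b`, `c`. -/
noncomputable abbrev triCorolla {M : Type v} [MulOneClass M] (a b c : M) :
    (freeOperad K (Triangle M)).obj 1 :=
  freeCorolla K (Triangle.mk a b c)

/-- The three families of relations, all in arity `3`. -/
inductive NCRelation : ∀ n, (freeOperad K (Triangle M)).obj n → Prop
  | rel1 (p₀ p₁ p₂ q₀ q₁ q₂ r₀ r₁ : M) (h : p₁ * q₀ = r₁ * r₀) (h' : r₁ * r₀ ≠ 1) :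
    NCRelation (1 + 1)
      ((freeOperad K (Triangle M)).comp 0 (triCorolla K p₀ p₁ p₂) (triCorolla K q₀ q₁ q₂) -
        (freeOperad K (Triangle M)).comp 0 (triCorolla K p₀ r₁ p₂) (triCorolla K r₀ q₁ q₂))
  | rel2 (p₀ p₁ p₂ q₀ q₁ q₂ r₀ r₂ : M) (h : p₁ * q₀ = 1) (h' : r₂ * r₀ = 1) :
    NCRelation (1 + 1)
      ((freeOperad K (Triangle M)).comp 0 (triCorolla K p₀ p₁ p₂) (triCorolla K q₀ q₁ q₂) -
        (freeOperad K (Triangle M)).comp 1 (triCorolla K p₀ q₁ r₂) (triCorolla K r₀ q₂ p₂))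
  | rel3 (p₀ p₁ p₂ q₀ q₁ q₂ r₀ r₂ : M) (h : p₂ * q₀ = r₂ * r₀) (h' : r₂ * r₀ ≠ 1) :
    NCRelation (1 + 1)
      ((freeOperad K (Triangle M)).comp 1 (triCorolla K p₀ p₁ p₂) (triCorolla K q₀ q₁ q₂) -
        (freeOperad K (Triangle M)).comp 1 (triCorolla K p₀ p₁ r₂) (triCorolla K r₀ q₁ q₂))

/-- The space of relations of `NC M`. -/
noncomputable def ncRelations (n : ℕ) : Submodule K ((freeOperad K (Triangle M)).obj n) :=
  Submodule.span K {x | NCRelation K M n x}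

/-- The quotient of the free operad on the `M`-triangles by the ideal generated by the
relations. -/
noncomputable def ncPresented : NSOperad.{u, max u v} K :=
  (NSOperad.OperadIdeal.generated (freeOperad K (Triangle M)) (ncRelations K M)).quotient

variable {M} in
/-- The class of the corolla labeled by the `M`-triangle `p`. -/
noncomputable def ncPresentedGenerator (p : Triangle M) : (ncPresented K M).obj 1 :=
  (NSOperad.OperadIdeal.generated (freeOperad K (Triangle M)) (ncRelations K M)).proj 1
    (freeCorolla K p)

open SyntaxTree in
/-- The rewrite rule orienting the relations. -/
inductive NCRule : BinaryTree (Triangle M) → BinaryTree (Triangle M) → Prop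
  | rule1 (p₀ p₁ p₂ q₀ q₁ q₂ : M) (h : q₀ ≠ 1) :
    NCRule (graft (corolla (Triangle.mk p₀ p₁ p₂)) 0 (corolla (Triangle.mk q₀ q₁ q₂)))
      (graft (corolla (Triangle.mk p₀ (p₁ * q₀) p₂)) 0 (corolla (Triangle.mk 1 q₁ q₂)))
  | rule2 (p₀ p₁ p₂ q₀ q₁ q₂ : M) (h : p₁ * q₀ = 1) :
    NCRule (graft (corolla (Triangle.mk p₀ p₁ p₂)) 0 (corolla (Triangle.mk q₀ q₁ q₂)))
      (graft (corolla (Triangle.mk p₀ q₁ 1)) 1 (corolla (Triangle.mk 1 q₂ p₂)))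
  | rule3 (p₀ p₁ p₂ q₀ q₁ q₂ : M) (h : q₀ ≠ 1) :
    NCRule (graft (corolla (Triangle.mk p₀ p₁ p₂)) 1 (corolla (Triangle.mk q₀ q₁ q₂)))
      (graft (corolla (Triangle.mk p₀ p₁ (p₂ * q₀))) 1 (corolla (Triangle.mk 1 q₁ q₂)))

end NCPresentation

/-! A syntax tree on triangles is a triangulated polygon, and gluing its triangles evaluates it to a
clique: the diagonals of the triangulation carry the product of the two labels glued there, and all
other diagonals carry the unit. Evaluation is compatible with grafting (`evalLab_graft`), and its
values are noncrossing because the diagonals of a triangulation are (`noncrossing_evalLab`).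
Conversely, a noncrossing clique can be cut along a triangle on its base whose third vertex is the
last one, before the final vertex, joined to vertex 1 by a solid arc, or vertex 2 if there is none.
No solid arc is crossed by this cut, so induction applies (`exists_eval_eq`). This gives generation
by the triangles.

Two trees with the same value differ only in how each product is shared between the two glued sides
and in how unit-labeled diagonals are chosen. The rewrite rule fixes both: it moves each label to
the upper triangle, and it rotates to the right across diagonals labeled by the unit. It preserves
the value and lowers `weight`. A normal form can be read off its value, since the third vertex of
its root triangle is the one described above (`numLeaves_left_le`,
`evalLab_injective_of_normalForm`). So each noncrossing clique is the value of exactly one normal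
form. Confluence follows without any study of critical pairs: trees of equal arity and equal value
share their normal form (`exists_common_reduct`).

Linearly, the relations evaluate to zero, so the ideal lies in the kernel of evaluation. Trees with
a common reduct are congruent modulo the ideal, so the quotient map factors through evaluation and
the kernel lies in the ideal (`ncIdeal_eq_ker`). The presentation is then the first isomorphism
theorem, and the Hilbert series counts noncrossing cliques, that is, normal forms. -/

/-! ### Triangles and the evaluation of syntax trees -/

namespace Triangle

variable {M : Type v} [MulOneClass M]

@[simp]
theorem lab_base (a b c : M) : (Triangle.mk a b c).lab 1 3 = a := by
  simp [Clique.lab, Triangle.mk]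

@[simp]
theorem lab_fst (a b c : M) : (Triangle.mk a b c).lab 1 2 = b := by
  simp [Clique.lab, Triangle.mk]

@[simp]
theorem lab_snd (a b c : M) : (Triangle.mk a b c).lab 2 3 = c := by
  simp [Clique.lab, Triangle.mk]

theorem ext_edges {p q : Triangle M} (h₀ : p.lab 1 3 = q.lab 1 3) (h₁ : p.lab 1 2 = q.lab 1 2)
    (h₂ : p.lab 2 3 = q.lab 2 3) : p = q := by
  refine Clique.ext_lab fun x y hx hxy hy => ?_
  obtain ⟨rfl, rfl⟩ | ⟨rfl, rfl⟩ | ⟨rfl, rfl⟩ :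
      x = 1 ∧ y = 3 ∨ x = 1 ∧ y = 2 ∨ x = 2 ∧ y = 3 := by omega
  exacts [h₀, h₁, h₂]

theorem mk_lab (p : Triangle M) : Triangle.mk (p.lab 1 3) (p.lab 1 2) (p.lab 2 3) = p :=
  ext_edges (by simp) (by simp) (by simp)

end Triangle

namespace SyntaxTree

variable {M : Type v} [MulOneClass M]

/-- The label of the arc `(x, y)` in the clique obtained by evaluating a syntax tree on triangles;
by convention `1` if `(x, y)` is not an arc. -/
def evalLab : BinaryTree (Triangle M) → ℕ → ℕ → M
  | .nil, _, _ => 1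
  | .node g a b, x, y =>
    if ¬(1 ≤ x ∧ x < y ∧ y ≤ a.numLeaves + b.numLeaves + 1) then 1
    else if x = 1 ∧ y = a.numLeaves + b.numLeaves + 1 then g.lab 1 3
    else if x = 1 ∧ y = a.numLeaves + 1 then g.lab 1 2 * evalLab a x y
    else if x = a.numLeaves + 1 ∧ y = a.numLeaves + b.numLeaves + 1 then
      g.lab 2 3 * evalLab b 1 (b.numLeaves + 1)
    else if y ≤ a.numLeaves + 1 then evalLab a x y
    else if a.numLeaves + 1 ≤ x then evalLab b (x - a.numLeaves) (y - a.numLeaves)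
    else 1

theorem evalLab_outside (t : BinaryTree (Triangle M)) {x y : ℕ}
    (h : ¬(1 ≤ x ∧ x < y ∧ y ≤ t.numLeaves + 1)) : evalLab t x y = 1 := by
  cases t with
  | nil => rfl
  | node g a b => exact if_pos h

theorem evalLab_of_numLeaves_eq_one {t : BinaryTree (Triangle M)} (h : t.numLeaves = 1)
    (x y : ℕ) : evalLab t x y = 1 := by
  cases t with
  | nil => rfl
  | node g a b =>
    have := numLeaves_pos a
    have := numLeaves_pos b
    simp only [BinaryTree.numLeaves] at h
    omega

/-- The clique obtained by evaluating a syntax tree on triangles. -/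
def eval {n : ℕ} (t : BinaryTree (Triangle M)) (ht : t.numLeaves = n + 1) : Clique M n where
  label e := evalLab t e.1.1 e.1.2
  label_of_size_one h e := by
    subst h
    exact evalLab_of_numLeaves_eq_one ht _ _

theorem lab_eval {n : ℕ} (t : BinaryTree (Triangle M)) (ht : t.numLeaves = n + 1) (x y : ℕ) :
    (eval t ht).lab x y = evalLab t x y := by
  unfold Clique.lab
  split_ifs with h
  · rfl
  · refine (evalLab_outside _ ?_).symm
    rw [ht]
    exact h

theorem eval_eq_iff {n : ℕ} {t s : BinaryTree (Triangle M)} (ht : t.numLeaves = n + 1)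
    (hs : s.numLeaves = n + 1) : eval t ht = eval s hs ↔ evalLab t = evalLab s := by
  constructor
  · intro h
    funext x y
    rw [← lab_eval t ht, ← lab_eval s hs, h]
  · intro h
    refine Clique.ext_lab fun x y _ _ _ => ?_
    rw [lab_eval, lab_eval, h]

theorem evalLab_corolla (g : Triangle M) (x y : ℕ) : evalLab (corolla g) x y = g.lab x y := by
  by_cases h : 1 ≤ x ∧ x < y ∧ y ≤ 3
  · obtain ⟨rfl, rfl⟩ | ⟨rfl, rfl⟩ | ⟨rfl, rfl⟩ :
      x = 1 ∧ y = 3 ∨ x = 1 ∧ y = 2 ∨ x = 2 ∧ y = 3 := by omega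
    all_goals simp [corolla, evalLab]
  · rw [evalLab_outside _ h, Clique.lab_outside _ h]

theorem eval_corolla (g : Triangle M) (h : (corolla g).numLeaves = 1 + 1) :
    eval (corolla g) h = g :=
  Clique.ext_lab fun x y _ _ _ => by rw [lab_eval, evalLab_corolla]

set_option maxHeartbeats 4000000 in
/-- Evaluation turns grafting into the gluing of cliques. -/
theorem evalLab_graft (t s : BinaryTree (Triangle M)) (i : ℕ) (hi : i < t.numLeaves) (x y : ℕ)
    (h : 1 ≤ x ∧ x < y ∧ y + 1 ≤ t.numLeaves + s.numLeaves + 1) :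
    evalLab (graft t i s) x y =
      if y ≤ i + 1 then evalLab t x y
      else if (x ≤ i + 1 ∧ i + 1 + s.numLeaves ≤ y) ∧ ¬(x = i + 1 ∧ y = i + 1 + s.numLeaves) then
        evalLab t x (y - s.numLeaves + 1)
      else if i + 1 + s.numLeaves ≤ x then evalLab t (x - s.numLeaves + 1) (y - s.numLeaves + 1)
      else if (i + 1 ≤ x ∧ x < y ∧ y ≤ i + 1 + s.numLeaves) ∧
          ¬(x = i + 1 ∧ y = i + 1 + s.numLeaves) then
        evalLab s (x - i) (y - i)
      else if x = i + 1 ∧ y = i + 1 + s.numLeaves then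
        evalLab t (i + 1) (i + 2) * evalLab s 1 (s.numLeaves + 1)
      else 1 := by
  have hs := numLeaves_pos s
  induction t generalizing i x y with
  | nil =>
    simp only [BinaryTree.numLeaves] at hi h
    obtain rfl : i = 0 := by omega
    simp only [graft, evalLab, one_mul]
    grind
  | node g a b ha hb =>
    simp only [BinaryTree.numLeaves] at hi h
    have pa := numLeaves_pos a
    have pb := numLeaves_pos b
    by_cases hia : i < a.numLeaves
    · have hn := numLeaves_graft a s i hia
      have hn' : (graft a i s).numLeaves = a.numLeaves + s.numLeaves - 1 := by omega
      simp only [graft, if_pos hia]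
      simp only [evalLab, hn']
      have e1 := ha i hia x y
      have e2 := ha i hia 1 (a.numLeaves + s.numLeaves - 1 + 1)
      -- Associativity is never needed: the edge of `a` receiving `s` is also the base of `a` only
      -- if `a` is a leaf, and then its label is the unit. Otherwise the products with the label of
      -- `g` and with the base of `s` sit on different arcs. The same holds for `b` in the other
      -- case.
      have o1 := evalLab_of_numLeaves_eq_one (t := a)
      have o2 := evalLab_of_numLeaves_eq_one (t := b)
      clear ha hb
      grind (splits := 60) [mul_one, one_mul, evalLab_outside]
    · have hn := numLeaves_graft b s (i - a.numLeaves) (by omega)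
      have hn' : (graft b (i - a.numLeaves) s).numLeaves = b.numLeaves + s.numLeaves - 1 := by omega
      simp only [graft, if_neg hia]
      simp only [evalLab, hn']
      have e1 := hb (i - a.numLeaves) (by omega) (x - a.numLeaves) (y - a.numLeaves)
      have e2 := hb (i - a.numLeaves) (by omega) 1 (b.numLeaves + s.numLeaves - 1 + 1)
      have o1 := evalLab_of_numLeaves_eq_one (t := a)
      have o2 := evalLab_of_numLeaves_eq_one (t := b)
      clear ha hb
      grind (splits := 60) [mul_one, one_mul, evalLab_outside]

theorem eval_graft {n m : ℕ} (i : Fin (n + 1)) {t s : BinaryTree (Triangle M)}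
    (ht : t.numLeaves = n + 1) (hs : s.numLeaves = m + 1)
    (h : (graft t i s).numLeaves = n + m + 1) :
    eval (graft t i s) h = Clique.comp i (eval t ht) (eval s hs) := by
  refine Clique.ext_lab fun x y h1 h2 h3 => ?_
  rw [lab_eval, Clique.lab_comp _ _ _ _ _ ⟨h1, h2, h3⟩, Clique.compLab,
    evalLab_graft t s i (by omega) x y (by omega)]
  simp only [lab_eval, hs]
  split_ifs <;> first | rfl | (congr 1 <;> omega)

/-! ### Rewriting steps and their invariants -/

/-- One-step rewriting, described recursively. -/
inductive LocalStep : BinaryTree (Triangle M) → BinaryTree (Triangle M) → Prop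
  | absorb_left (p₀ p₁ p₂ q₀ q₁ q₂ : M) (h : q₀ ≠ 1) (a b c : BinaryTree (Triangle M)) :
    LocalStep (.node (.mk p₀ p₁ p₂) (.node (.mk q₀ q₁ q₂) a b) c)
      (.node (.mk p₀ (p₁ * q₀) p₂) (.node (.mk 1 q₁ q₂) a b) c)
  | rotate (p₀ p₁ p₂ q₀ q₁ q₂ : M) (h : p₁ * q₀ = 1) (a b c : BinaryTree (Triangle M)) :
    LocalStep (.node (.mk p₀ p₁ p₂) (.node (.mk q₀ q₁ q₂) a b) c)
      (.node (.mk p₀ q₁ 1) a (.node (.mk 1 q₂ p₂) b c))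
  | absorb_right (p₀ p₁ p₂ q₀ q₁ q₂ : M) (h : q₀ ≠ 1) (a b c : BinaryTree (Triangle M)) :
    LocalStep (.node (.mk p₀ p₁ p₂) a (.node (.mk q₀ q₁ q₂) b c))
      (.node (.mk p₀ p₁ (p₂ * q₀)) a (.node (.mk 1 q₁ q₂) b c))
  | left (g : Triangle M) {a a' : BinaryTree (Triangle M)} (b : BinaryTree (Triangle M))
    (h : LocalStep a a') : LocalStep (.node g a b) (.node g a' b)
  | right (g : Triangle M) (a : BinaryTree (Triangle M)) {b b' : BinaryTree (Triangle M)}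
    (h : LocalStep b b') : LocalStep (.node g a b) (.node g a b')

theorem localStep_of_rule {s s' : BinaryTree (Triangle M)} (h : NCRule M s s')
    (f : ℕ → BinaryTree (Triangle M)) : LocalStep (graftAll s f) (graftAll s' f) := by
  cases h with
  | rule1 p₀ p₁ p₂ q₀ q₁ q₂ h => exact .absorb_left _ _ _ _ _ _ h _ _ _
  | rule2 p₀ p₁ p₂ q₀ q₁ q₂ h => exact .rotate _ _ _ _ _ _ h _ _ _
  | rule3 p₀ p₁ p₂ q₀ q₁ q₂ h => exact .absorb_right _ _ _ _ _ _ h _ _ _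

theorem LocalStep.graft {s s' : BinaryTree (Triangle M)} (h : LocalStep s s')
    (u : BinaryTree (Triangle M)) (i : ℕ) : LocalStep (graft u i s) (graft u i s') := by
  induction u generalizing i with
  | nil => exact h
  | node g a b ha hb =>
    simp only [SyntaxTree.graft]
    split_ifs
    · exact .left _ _ (ha _)
    · exact .right _ _ (hb _)

theorem step_of_rule {s s' : BinaryTree (Triangle M)} (h : NCRule M s s')
    (f : ℕ → BinaryTree (Triangle M)) :
    RewriteRule.Step (NCRule M) (graftAll s f) (graftAll s' f) :=
  ⟨.nil, 0, s, s', f, by simp, h, rfl, rfl⟩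

/-- This replaces the quantification over occurrences by a description suited to structural
induction; the subtrees `a`, `b`, `c` are those grafted on the three leaves of the pattern. -/
theorem step_iff_localStep {t t' : BinaryTree (Triangle M)} :
    RewriteRule.Step (NCRule M) t t' ↔ LocalStep t t' := by
  constructor
  · rintro ⟨u, i, s, s', f, -, h, rfl, rfl⟩
    exact (localStep_of_rule h f).graft u i
  · intro h
    induction h with
    | absorb_left p₀ p₁ p₂ q₀ q₁ q₂ h a b c =>
      exact step_of_rule (.rule1 p₀ p₁ p₂ q₀ q₁ q₂ h)
        fun j => if j = 0 then a else if j = 1 then b else c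
    | rotate p₀ p₁ p₂ q₀ q₁ q₂ h a b c =>
      exact step_of_rule (.rule2 p₀ p₁ p₂ q₀ q₁ q₂ h)
        fun j => if j = 0 then a else if j = 1 then b else c
    | absorb_right p₀ p₁ p₂ q₀ q₁ q₂ h a b c =>
      exact step_of_rule (.rule3 p₀ p₁ p₂ q₀ q₁ q₂ h)
        fun j => if j = 0 then a else if j = 1 then b else c
    | @left g a a' b h ih =>
      obtain ⟨u, i, s, s', f, hi, hr, rfl, rfl⟩ := ih
      exact ⟨.node g u b, i, s, s', f, by simp only [BinaryTree.numLeaves]; omega, hr,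
        by simp [SyntaxTree.graft, hi], by simp [SyntaxTree.graft, hi]⟩
    | @right g a b b' h ih =>
      obtain ⟨u, i, s, s', f, hi, hr, rfl, rfl⟩ := ih
      -- The leaves of the right subtree are numbered after those of `a`.
      exact ⟨.node g a u, a.numLeaves + i, s, s', f, by simp only [BinaryTree.numLeaves]; omega, hr,
        by simp [SyntaxTree.graft], by simp [SyntaxTree.graft]⟩

theorem step_eq_localStep : RewriteRule.Step (NCRule M) = LocalStep := by
  funext t t'
  exact propext step_iff_localStep

theorem LocalStep.numLeaves_eq {t t' : BinaryTree (Triangle M)} (h : LocalStep t t') :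
    t.numLeaves = t'.numLeaves := by
  induction h <;> simp_all [BinaryTree.numLeaves, add_assoc]

-- Absorbing a label leaves the product on the glued arc unchanged, since the lower triangle keeps
-- the unit. A rotation exchanges the two diagonals of a quadrilateral, both labeled by the unit:
-- the old one because `p₁ * q₀ = 1`, the new one because both of its sides are `1`.
set_option maxHeartbeats 1000000 in
theorem LocalStep.evalLab_eq {t t' : BinaryTree (Triangle M)} (h : LocalStep t t') :
    evalLab t = evalLab t' := by
  induction h with
  | absorb_left p₀ p₁ p₂ q₀ q₁ q₂ h a b c =>
    have := numLeaves_pos c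
    funext x y
    simp only [evalLab, BinaryTree.numLeaves, Triangle.lab_base, Triangle.lab_fst,
      Triangle.lab_snd]
    grind [mul_one]
  | rotate p₀ p₁ p₂ q₀ q₁ q₂ h a b c =>
    have := numLeaves_pos a
    have := numLeaves_pos b
    have := numLeaves_pos c
    funext x y
    simp only [evalLab, BinaryTree.numLeaves, Triangle.lab_base, Triangle.lab_fst,
      Triangle.lab_snd]
    grind (splits := 40) [mul_one]
  | absorb_right p₀ p₁ p₂ q₀ q₁ q₂ h a b c =>
    have := numLeaves_pos a
    funext x y
    simp only [evalLab, BinaryTree.numLeaves, Triangle.lab_base, Triangle.lab_fst,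
      Triangle.lab_snd]
    grind [mul_one]
  | left g b h ih => funext x y; simp only [evalLab, ih, h.numLeaves_eq]
  | right g a h ih => funext x y; simp only [evalLab, ih, h.numLeaves_eq]

/-! ### Termination -/

open Classical in
/-- A weight of syntax trees that is decreased by rewriting: the number of nodes with a solid base
plus the sum over all nodes of the degree of the left subtree. -/
noncomputable def weight : BinaryTree (Triangle M) → ℕ
  | .nil => 0
  | .node g a b => (if g.lab 1 3 = 1 then 0 else 1) + a.numNodes + weight a + weight b

/-- Absorption keeps the shape and turns one solid base into a unit. A rotation creates no solid
base and lowers the sum of the degrees of left subtrees by one plus the degree of `a`. -/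
theorem LocalStep.weight_lt {t t' : BinaryTree (Triangle M)} (h : LocalStep t t') :
    weight t' < weight t := by
  induction h with
  | left g b h ih =>
    -- The degree of the left subtree enters the weight of the node, so its invariance is required.
    have := h.numLeaves_eq
    simp only [BinaryTree.numLeaves_eq_numNodes_succ] at this
    simp only [weight]
    omega
  | right g a h ih => simp only [weight]; omega
  | _ =>
    simp only [weight, BinaryTree.numNodes, Triangle.lab_base, if_true]
    split_ifs <;> first | omega | contradiction

theorem terminating : RewriteRule.Terminating (NCRule M) := by
  rintro ⟨t, ht⟩
  have h : ∀ j, weight (t (j + 1)) < weight (t j) := fun j => (step_iff_localStep.1 (ht j)).weight_lt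
  have h' : ∀ j, weight (t j) + j ≤ weight (t 0) := by
    intro j
    induction j with
    | zero => simp
    | succ j ih => have := h j; omega
  have := h' (weight (t 0) + 1)
  omega

theorem evalLab_eq_of_reflTransGen {t t' : BinaryTree (Triangle M)}
    (h : Relation.ReflTransGen LocalStep t t') : evalLab t = evalLab t' := by
  induction h with
  | refl => rfl
  | tail _ h ih => exact ih.trans h.evalLab_eq

theorem numLeaves_eq_of_reflTransGen {t t' : BinaryTree (Triangle M)}
    (h : Relation.ReflTransGen LocalStep t t') : t.numLeaves = t'.numLeaves := by
  induction h with
  | refl => rfl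
  | tail _ h ih => exact ih.trans h.numLeaves_eq

theorem exists_normalForm (t : BinaryTree (Triangle M)) :
    ∃ t', Relation.ReflTransGen LocalStep t t' ∧ RewriteRule.IsNormalForm (NCRule M) t' := by
  induction hw : weight t using Nat.strong_induction_on generalizing t with
  | _ w ih =>
    by_cases h : RewriteRule.IsNormalForm (NCRule M) t
    · exact ⟨t, .refl, h⟩
    · simp only [RewriteRule.IsNormalForm, not_forall, not_not, step_iff_localStep] at h
      obtain ⟨s, hs⟩ := h
      obtain ⟨t', hred, hnormal⟩ := ih _ (hw ▸ hs.weight_lt) s rfl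
      exact ⟨t', .head hs hred, hnormal⟩

/-! ### Uniqueness of normal forms and confluence -/

/-- The base of the evaluation of a subtree of a normal form is not solid. -/
theorem base_eq_one_left {g : Triangle M} {a b : BinaryTree (Triangle M)}
    (h : ∀ t', ¬ LocalStep (.node g a b) t') : evalLab a 1 (a.numLeaves + 1) = 1 := by
  cases a with
  | nil => rfl
  | node q a₁ a₂ =>
    by_contra hq
    have := numLeaves_pos a₁
    simp only [evalLab, BinaryTree.numLeaves] at hq
    rw [if_neg (by omega), if_pos (by simp)] at hq
    rw [← g.mk_lab, ← Triangle.mk_lab q] at h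
    exact h _ (.absorb_left _ _ _ _ _ _ hq _ _ _)

theorem base_eq_one_right {g : Triangle M} {a b : BinaryTree (Triangle M)}
    (h : ∀ t', ¬ LocalStep (.node g a b) t') : evalLab b 1 (b.numLeaves + 1) = 1 := by
  cases b with
  | nil => rfl
  | node q b₁ b₂ =>
    by_contra hq
    have := numLeaves_pos b₁
    simp only [evalLab, BinaryTree.numLeaves] at hq
    rw [if_neg (by omega), if_pos (by simp)] at hq
    rw [← g.mk_lab, ← Triangle.mk_lab q] at h
    exact h _ (.absorb_right _ _ _ _ _ _ hq _ _ _)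

/-- In a normal form, the first edge of a node whose left subtree is not a leaf is solid. -/
theorem fst_ne_one {g : Triangle M} {a b : BinaryTree (Triangle M)}
    (h : ∀ t', ¬ LocalStep (.node g a b) t') (ha : 1 < a.numLeaves) : g.lab 1 2 ≠ 1 := by
  intro hg
  have hb := base_eq_one_left h
  cases a with
  | nil => simp at ha
  | node q a₁ a₂ =>
    simp only [evalLab, BinaryTree.numLeaves] at hb ha
    rw [if_neg (by omega), if_pos (by simp)] at hb
    rw [← g.mk_lab, ← Triangle.mk_lab q] at h
    exact h _ (.rotate _ _ _ _ _ _ (by rw [hg, hb, one_mul]) _ _ _)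

/-- If `a'` were larger than `a`, the arc from vertex 1 to the split vertex of the second tree would
be solid there by `fst_ne_one`. In the first tree the same arc jumps over the split vertex without
being the base, so its label is the unit. -/
theorem numLeaves_left_le {g g' : Triangle M} {a b a' b' : BinaryTree (Triangle M)}
    (h' : ∀ t', ¬ LocalStep (.node g' a' b') t')
    (hn : a.numLeaves + b.numLeaves = a'.numLeaves + b'.numLeaves)
    (he : evalLab (.node g a b) = evalLab (.node g' a' b')) : a'.numLeaves ≤ a.numLeaves := by
  by_contra hlt
  have pa := numLeaves_pos a
  have pb := numLeaves_pos b'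
  have h1 := base_eq_one_left h'
  have h2 := fst_ne_one h' (by omega)
  have h3 := congrFun (congrFun he 1) (a'.numLeaves + 1)
  simp only [evalLab] at h3
  -- On the left every case of `evalLab` fails and the default `1` remains; on the right the arc is
  -- the first edge of the root triangle.
  rw [if_neg (by omega), if_neg (by omega), if_neg (by omega), if_neg (by omega),
    if_neg (by omega), if_neg (by omega), if_neg (by omega), if_neg (by omega),
    if_pos (by simp), h1, mul_one] at h3
  exact h2 h3.symm

/-- A normal form is determined by its evaluation. -/
theorem evalLab_injective_of_normalForm {t t' : BinaryTree (Triangle M)}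
    (h : ∀ s, ¬ LocalStep t s) (h' : ∀ s, ¬ LocalStep t' s) (hn : t.numLeaves = t'.numLeaves)
    (he : evalLab t = evalLab t') : t = t' := by
  induction t generalizing t' with
  | nil =>
    cases t' with
    | nil => rfl
    | node g a b =>
      have := numLeaves_pos a
      have := numLeaves_pos b
      simp only [BinaryTree.numLeaves] at hn
      omega
  | node g a b iha ihb =>
    cases t' with
    | nil =>
      have := numLeaves_pos a
      have := numLeaves_pos b
      simp only [BinaryTree.numLeaves] at hn
      omega
    | node g' a' b' =>
      simp only [BinaryTree.numLeaves] at hn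
      have hl : a.numLeaves = a'.numLeaves :=
        le_antisymm (numLeaves_left_le h hn.symm he.symm) (numLeaves_left_le h' hn he)
      have hr : b.numLeaves = b'.numLeaves := by omega
      have a1 := base_eq_one_left h
      have a1' := base_eq_one_left h'
      have b1 := base_eq_one_right h
      have b1' := base_eq_one_right h'
      have pa := numLeaves_pos a
      have pb := numLeaves_pos b
      have hxy := fun x y => congrFun (congrFun he x) y
      simp only [evalLab, ← hl, ← hr] at hxy
      rw [← hl] at a1'
      rw [← hr] at b1'
      -- The subtrees have unit bases, so the arcs glued to the root triangle carry exactly its edge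
      -- labels.
      have hg : g = g' := by
        refine Triangle.ext_edges ?_ ?_ ?_
        · have := hxy 1 (a.numLeaves + b.numLeaves + 1)
          grind
        · have := hxy 1 (a.numLeaves + 1)
          rw [a1, a1'] at this
          grind [mul_one]
        · have := hxy (a.numLeaves + 1) (a.numLeaves + b.numLeaves + 1)
          rw [b1, b1'] at this
          grind [mul_one]
      -- The value of the whole tree determines every label of a subtree except its base, which is
      -- the unit on both sides.
      have ha : a = a' := by
        refine iha (fun s hs => h _ (.left _ _ hs)) (fun s hs => h' _ (.left _ _ hs)) hl ?_
        funext x y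
        by_cases hc : 1 ≤ x ∧ x < y ∧ y ≤ a.numLeaves + 1
        · have := hxy x y
          grind
        · rw [evalLab_outside _ hc, evalLab_outside _ (hl ▸ hc)]
      have hb : b = b' := by
        refine ihb (fun s hs => h _ (.right _ _ hs)) (fun s hs => h' _ (.right _ _ hs)) hr ?_
        funext x y
        by_cases hc : 1 ≤ x ∧ x < y ∧ y ≤ b.numLeaves + 1
        · have := hxy (x + a.numLeaves) (y + a.numLeaves)
          simp only [Nat.add_sub_cancel] at this
          grind [mul_one]
        · rw [evalLab_outside _ hc, evalLab_outside _ (hr ▸ hc)]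
      rw [hg, ha, hb]

theorem isNormalForm_iff {t : BinaryTree (Triangle M)} :
    RewriteRule.IsNormalForm (NCRule M) t ↔ ∀ s, ¬ LocalStep t s := by
  simp only [RewriteRule.IsNormalForm, step_iff_localStep]

/-- Two trees with the same evaluation have a common rewriting. -/
theorem exists_common_reduct {t t' : BinaryTree (Triangle M)} (hn : t.numLeaves = t'.numLeaves)
    (he : evalLab t = evalLab t') :
    ∃ s, Relation.ReflTransGen LocalStep t s ∧ Relation.ReflTransGen LocalStep t' s := by
  obtain ⟨s, hs, hs'⟩ := exists_normalForm t
  obtain ⟨r, hr, hr'⟩ := exists_normalForm t'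
  obtain rfl : s = r := by
    refine evalLab_injective_of_normalForm (isNormalForm_iff.1 hs') (isNormalForm_iff.1 hr') ?_ ?_
    · rw [← numLeaves_eq_of_reflTransGen hs, ← numLeaves_eq_of_reflTransGen hr, hn]
    · rw [← evalLab_eq_of_reflTransGen hs, ← evalLab_eq_of_reflTransGen hr, he]
  exact ⟨s, hs, hr⟩

/-- Both reducts keep the arity and the value of `t`, hence have the same normal form. -/
theorem confluent : RewriteRule.Confluent (NCRule M) := by
  intro t r₁ r₂ h₁ h₂
  rw [step_eq_localStep] at *
  refine exists_common_reduct ?_ ?_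
  · rw [← numLeaves_eq_of_reflTransGen h₁, ← numLeaves_eq_of_reflTransGen h₂]
  · rw [← evalLab_eq_of_reflTransGen h₁, ← evalLab_eq_of_reflTransGen h₂]

/-! ### Noncrossing cliques as the values of trees -/

/-- A solid arc other than the base stays on one side of the split vertex of the root. Two crossing
arcs cannot lie on different sides, and nothing crosses the base, so the crossing takes place inside
one subtree. -/
theorem noncrossing_evalLab (t : BinaryTree (Triangle M)) {x y x' y' : ℕ} (h1 : x < x')
    (h2 : x' < y) (h3 : y < y') (h : evalLab t x y ≠ 1) : evalLab t x' y' = 1 := by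
  induction t generalizing x y x' y' with
  | nil => rfl
  | node g a b iha ihb =>
    by_contra h'
    simp only [evalLab] at h h'
    split_ifs at h h' <;> first
      | omega
      | exact h rfl
      | exact h' rfl
      | exact h' (iha (by omega) (by omega) (by omega) h)
      | exact h' (ihb (by omega) (by omega) (by omega) h)

theorem noncrossing_eval {n : ℕ} (t : BinaryTree (Triangle M)) (ht : t.numLeaves = n + 1) :
    (eval t ht).Noncrossing := by
  refine Clique.Noncrossing.wlog fun x y x' y' h1 h2 h3 h h' => h' ?_
  rw [lab_eval] at h ⊢
  exact noncrossing_evalLab _ h1 h2 h3 h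

/-- The clique induced by `p` on the vertices `k + 1, …, k + n + 2`, with its base relabeled by
`1`. -/
def inducedClique {m : ℕ} (p : Clique M m) (k n : ℕ) : Clique M n where
  label e := if e.1.1 = 1 ∧ e.1.2 = n + 2 then 1 else p.lab (e.1.1 + k) (e.1.2 + k)
  label_of_size_one h e := by
    obtain ⟨⟨x, y⟩, h1, h2, h3⟩ := e
    dsimp only at h1 h2 h3 ⊢
    rw [if_pos (by omega)]

theorem lab_inducedClique {m : ℕ} (p : Clique M m) (k n x y : ℕ) :
    (inducedClique p k n).lab x y =
      if 1 ≤ x ∧ x < y ∧ y ≤ n + 2 ∧ ¬(x = 1 ∧ y = n + 2) then p.lab (x + k) (y + k) else 1 := by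
  unfold Clique.lab inducedClique
  dsimp only
  unfold Clique.lab
  split_ifs <;> first | rfl | omega

theorem noncrossing_inducedClique {m : ℕ} {p : Clique M m} (hp : p.Noncrossing) (k n : ℕ) :
    (inducedClique p k n).Noncrossing := by
  refine Clique.Noncrossing.wlog fun x y x' y' h1 h2 h3 h h' => h' ?_
  rw [lab_inducedClique] at h ⊢
  split_ifs at h ⊢
  · exact hp.elim (by omega) (by omega) (by omega) h
  · exact absurd rfl h
  · rfl
  · rfl

/-- The vertex `l + 1` is the last one, apart from the last vertex of the clique, that is joined
to the vertex `1` by an edge or a solid arc. -/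
theorem exists_split {n : ℕ} (p : Clique M (n + 1)) :
    ∃ l, 1 ≤ l ∧ l ≤ n + 1 ∧ (1 < l → p.lab 1 (l + 1) ≠ 1) ∧
      ∀ y, l + 1 < y → y < n + 3 → p.lab 1 y = 1 := by
  classical
  -- The alternative `l = 1` admits the edge `(1, 2)` whatever its label, so a candidate always
  -- exists; the bound `n + 1` excludes the base `(1, n + 3)`.
  refine ⟨Nat.findGreatest (fun l => l = 1 ∨ p.lab 1 (l + 1) ≠ 1) (n + 1), ?_, ?_, ?_, ?_⟩
  · exact Nat.le_findGreatest (by omega) (Or.inl rfl)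
  · exact Nat.findGreatest_le _
  · intro h
    have := Nat.findGreatest_spec (P := fun l => l = 1 ∨ p.lab 1 (l + 1) ≠ 1) (n := n + 1)
      (m := 1) (by omega) (Or.inl rfl)
    rcases this with h' | h'
    · omega
    · exact h'
  · intro y h1 h2
    have := Nat.findGreatest_is_greatest (P := fun l => l = 1 ∨ p.lab 1 (l + 1) ≠ 1) (n := n + 1)
      (k := y - 1) (by omega) (by omega)
    rw [not_or, not_not, Nat.sub_add_cancel (by omega)] at this
    exact this.2

/-- Every noncrossing clique is the evaluation of a syntax tree on triangles. -/
theorem exists_eval_eq {n : ℕ} {p : Clique M n} (hp : p.Noncrossing) :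
    ∃ (t : BinaryTree (Triangle M)) (ht : t.numLeaves = n + 1), eval t ht = p := by
  induction n using Nat.strong_induction_on with
  | _ n ih =>
    cases n with
    | zero =>
      refine ⟨.nil, rfl, Clique.ext_lab fun x y _ _ _ => ?_⟩
      rw [Clique.lab_size_one, Clique.lab_size_one]
    | succ n =>
      obtain ⟨l, hl, hl', hsolid, hmax⟩ := exists_split p
      obtain ⟨l, rfl⟩ := Nat.exists_eq_add_of_le' hl
      -- The two pieces live on the vertices `1, …, l + 2` and `l + 2, …, n + 3`. Their bases are
      -- relabeled by the unit because the root triangle will carry those labels in full.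
      obtain ⟨a, ha, hpa⟩ := ih l (by omega) (noncrossing_inducedClique hp 0 l)
      obtain ⟨b, hb, hpb⟩ := ih (n - l) (by omega) (noncrossing_inducedClique hp (l + 1) (n - l))
      have ha' := fun x y => congrArg (fun q => Clique.lab q x y) hpa
      have hb' := fun x y => congrArg (fun q => Clique.lab q x y) hpb
      simp only [lab_eval, lab_inducedClique] at ha' hb'
      refine ⟨.node (.mk (p.lab 1 (n + 3)) (p.lab 1 (l + 2)) (p.lab (l + 2) (n + 3))) a b,
        by simp only [BinaryTree.numLeaves]; omega, Clique.ext_lab fun x y h1 h2 h3 => ?_⟩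
      rw [lab_eval]
      simp only [evalLab, ha, hb, ha', hb', Triangle.lab_base, Triangle.lab_fst,
        Triangle.lab_snd]
      -- No solid arc other than the base straddles the split vertex: from vertex 1 it would
      -- contradict maximality, and from a later vertex it would cross the arc `(1, l + 2)`, which
      -- is then solid.
      have hcross : x < l + 2 → l + 2 < y → ¬(x = 1 ∧ y = n + 3) → p.lab x y = 1 := by
        intro hx hy hxy
        by_cases hx1 : x = 1
        · subst hx1
          exact hmax y hy (by omega)
        · exact hp.elim (x := 1) (by omega) hx hy (hsolid (by omega))
      clear ih ha' hb' hpa hpb hp hmax hsolid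
      grind (splits := 40) [mul_one]

end SyntaxTree

/-! ### Congruence of trees modulo an operad ideal -/

namespace SyntaxTree

variable {G : Type v}

/-- Writing a node with partial compositions only makes the closure properties of ideals applicable
to subtrees. Grafting on the right leaf first keeps the number of the left one. -/
theorem graft_eq_node (g : G) (a b : BinaryTree G) :
    graft (graft (corolla g) 1 b) 0 a = .node g a b := by
  simp [graft, corolla]

theorem exists_numLeaves_eq (t : BinaryTree G) : ∃ n, t.numLeaves = n + 1 :=
  Nat.exists_eq_add_of_le' (numLeaves_pos t)

end SyntaxTree

section FreeOperad

open SyntaxTree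

variable (K : Type u) [Field K] {G : Type v}

theorem freeOperad_comp_treeBasis {n m : ℕ} (i : Fin (n + 1)) (t : SynTree G n)
    (s : SynTree G m) :
    (freeOperad K G).comp i (treeBasis K t) (treeBasis K s) =
      treeBasis K ((SynTree.setOperad G).comp i t s) :=
  ((SynTree.setOperad G).linComp_single K i t s 1 1).trans (by rw [mul_one]; rfl)

/-- The basis element of the free operad indexed by a tree. -/
noncomputable def treeElem {n : ℕ} (t : BinaryTree G) (h : t.numLeaves = n + 1) :
    (freeOperad K G).obj n :=
  treeBasis K ⟨t, h⟩

theorem freeOperad_comp_treeElem {n m : ℕ} (i : Fin (n + 1)) {t s : BinaryTree G}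
    (ht : t.numLeaves = n + 1) (hs : s.numLeaves = m + 1)
    (h : (graft t i s).numLeaves = n + m + 1) :
    (freeOperad K G).comp i (treeElem K t ht) (treeElem K s hs) = treeElem K (graft t i s) h :=
  freeOperad_comp_treeBasis K i ⟨t, ht⟩ ⟨s, hs⟩

variable {K} in
/-- Two trees of the same arity have the same class modulo a graded subspace. -/
def TreeCongr (I : ∀ n, Submodule K ((freeOperad K G).obj n)) (t s : BinaryTree G) : Prop :=
  ∀ n (ht : t.numLeaves = n + 1) (hs : s.numLeaves = n + 1),
    treeElem K t ht - treeElem K s hs ∈ I n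

variable {K}

theorem TreeCongr.graft_right (I : (freeOperad K G).OperadIdeal) {t s : BinaryTree G}
    (h : TreeCongr I.carrier t s) (hn : t.numLeaves = s.numLeaves) (u : BinaryTree G) {i : ℕ}
    (hi : i < u.numLeaves) : TreeCongr I.carrier (graft u i t) (graft u i s) := by
  intro n ht hs
  obtain ⟨a, ha⟩ := exists_numLeaves_eq u
  obtain ⟨b, hb⟩ := exists_numLeaves_eq t
  have := numLeaves_graft u t i hi
  obtain rfl : n = a + b := by omega
  have key := I.comp_mem_left (⟨i, by omega⟩ : Fin (a + 1)) (treeElem K u ha)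
    (h b hb (hn ▸ hb))
  rw [map_sub, freeOperad_comp_treeElem K _ _ _ ht, freeOperad_comp_treeElem K _ _ _ hs] at key
  exact key

theorem TreeCongr.graft_left (I : (freeOperad K G).OperadIdeal) {t s : BinaryTree G}
    (h : TreeCongr I.carrier t s) (hn : t.numLeaves = s.numLeaves) (u : BinaryTree G) {i : ℕ}
    (hi : i < t.numLeaves) : TreeCongr I.carrier (graft t i u) (graft s i u) := by
  intro n ht hs
  obtain ⟨a, ha⟩ := exists_numLeaves_eq t
  obtain ⟨b, hb⟩ := exists_numLeaves_eq u
  have := numLeaves_graft t u i hi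
  obtain rfl : n = a + b := by omega
  have key := I.comp_mem_right (⟨i, by omega⟩ : Fin (a + 1)) (treeElem K u hb)
    (h a ha (hn ▸ ha))
  rw [map_sub, LinearMap.sub_apply, freeOperad_comp_treeElem K _ _ _ ht,
    freeOperad_comp_treeElem K _ _ _ hs] at key
  exact key

theorem TreeCongr.node_left (I : (freeOperad K G).OperadIdeal) {t s : BinaryTree G}
    (h : TreeCongr I.carrier t s) (hn : t.numLeaves = s.numLeaves) (g : G) (b : BinaryTree G) :
    TreeCongr I.carrier (.node g t b) (.node g s b) := by
  rw [← graft_eq_node, ← graft_eq_node]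
  exact h.graft_right I hn _ (numLeaves_pos _)

theorem TreeCongr.node_right (I : (freeOperad K G).OperadIdeal) {t s : BinaryTree G}
    (h : TreeCongr I.carrier t s) (hn : t.numLeaves = s.numLeaves) (g : G) (a : BinaryTree G) :
    TreeCongr I.carrier (.node g a t) (.node g a s) := by
  rw [← graft_eq_node, ← graft_eq_node]
  refine (h.graft_right I hn (corolla g) (i := 1) (by simp [corolla])).graft_left I ?_ a
    (numLeaves_pos _)
  have h1 := numLeaves_graft (corolla g) t 1 (by simp [corolla])
  have h2 := numLeaves_graft (corolla g) s 1 (by simp [corolla])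
  omega

/-- This completes a pattern of degree 2 by arbitrary subtrees. Grafting from right to left keeps
the numbers of the remaining leaves. -/
theorem TreeCongr.graft_three (I : (freeOperad K G).OperadIdeal) {t s : BinaryTree G}
    (h : TreeCongr I.carrier t s) (ht : t.numLeaves = 3) (hs : s.numLeaves = 3)
    (a b c : BinaryTree G) :
    TreeCongr I.carrier (graft (graft (graft t 2 c) 1 b) 0 a)
      (graft (graft (graft s 2 c) 1 b) 0 a) := by
  have h1 := numLeaves_graft t c 2 (by omega)
  have h2 := numLeaves_graft s c 2 (by omega)
  have pc := numLeaves_pos c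
  have h3 := numLeaves_graft (graft t 2 c) b 1 (by omega)
  have h4 := numLeaves_graft (graft s 2 c) b 1 (by omega)
  exact ((h.graft_left I (by omega) c (by omega)).graft_left I (by omega) b (by omega)).graft_left
    I (by omega) a (numLeaves_pos _)

end FreeOperad

/-! ### The relations and the rewrite rule -/

section NCPresentation

open SyntaxTree

variable (K : Type u) [Field K] {M : Type v} [MulOneClass M]

theorem numLeaves_comp_left (p q : Triangle M) :
    (graft (corolla p) 0 (corolla q)).numLeaves = 1 + 1 + 1 := rfl

theorem numLeaves_comp_right (p q : Triangle M) :
    (graft (corolla p) 1 (corolla q)).numLeaves = 1 + 1 + 1 := rfl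

theorem comp_freeCorolla_left (p q : Triangle M) :
    (freeOperad K (Triangle M)).comp 0 (freeCorolla K p) (freeCorolla K q) =
      treeElem K (graft (corolla p) 0 (corolla q)) (numLeaves_comp_left p q) :=
  freeOperad_comp_treeElem K (0 : Fin (1 + 1)) _ _ _

theorem comp_freeCorolla_right (p q : Triangle M) :
    (freeOperad K (Triangle M)).comp 1 (freeCorolla K p) (freeCorolla K q) =
      treeElem K (graft (corolla p) 1 (corolla q)) (numLeaves_comp_right p q) :=
  freeOperad_comp_treeElem K (1 : Fin (1 + 1)) _ _ _

/-- The relations are differences of two trees of degree `2` related by the rewrite rule. -/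
theorem NCRelation.exists_trees {n : ℕ} {x : (freeOperad K (Triangle M)).obj n}
    (h : NCRelation K M n x) :
    ∃ (t s : BinaryTree (Triangle M)) (ht : t.numLeaves = n + 1) (hs : s.numLeaves = n + 1),
      t.numNodes = 2 ∧ s.numNodes = 2 ∧ Relation.EqvGen (NCRule M) t s ∧
      x = treeElem K t ht - treeElem K s hs := by
  cases h with
  | rel1 p₀ p₁ p₂ q₀ q₁ q₂ r₀ r₁ h h' =>
    refine ⟨_, _, numLeaves_comp_left _ _, numLeaves_comp_left _ _, rfl, rfl, ?_,
      congrArg₂ _ (comp_freeCorolla_left K _ _) (comp_freeCorolla_left K _ _)⟩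
    -- Every such tree is equivalent to the one whose lower base is the unit, which depends on `a`
    -- and `b` only through `a * b`.
    have key : ∀ a b : M, Relation.EqvGen (NCRule M)
        (graft (corolla (Triangle.mk p₀ a p₂)) 0 (corolla (Triangle.mk b q₁ q₂)))
        (graft (corolla (Triangle.mk p₀ (a * b) p₂)) 0 (corolla (Triangle.mk 1 q₁ q₂))) := by
      intro a b
      by_cases hb : b = 1
      · rw [hb, mul_one]
        exact .refl _
      · exact .rel _ _ (.rule1 _ _ _ _ _ _ hb)
    exact (key p₁ q₀).trans _ _ _ (h ▸ (key r₁ r₀).symm _ _)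
  | rel2 p₀ p₁ p₂ q₀ q₁ q₂ r₀ r₂ h h' =>
    refine ⟨_, _, numLeaves_comp_left _ _, numLeaves_comp_right _ _, rfl, rfl, ?_,
      congrArg₂ _ (comp_freeCorolla_left K _ _) (comp_freeCorolla_right K _ _)⟩
    refine .trans _ _ _ (.rel _ _ (.rule2 _ _ _ _ _ _ h)) ?_
    -- The rotation ends at the pair of labels `1`, `1`; any other pair with product `1` is brought
    -- there by absorption on the right.
    by_cases hr : r₀ = 1
    · rw [hr, mul_one] at h'
      rw [hr, h']
      exact .refl _
    · refine .symm _ _ (.rel _ _ ?_)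
      have := NCRule.rule3 p₀ q₁ r₂ r₀ q₂ p₂ hr
      rwa [h'] at this
  | rel3 p₀ p₁ p₂ q₀ q₁ q₂ r₀ r₂ h h' =>
    refine ⟨_, _, numLeaves_comp_right _ _, numLeaves_comp_right _ _, rfl, rfl, ?_,
      congrArg₂ _ (comp_freeCorolla_right K _ _) (comp_freeCorolla_right K _ _)⟩
    have key : ∀ a b : M, Relation.EqvGen (NCRule M)
        (graft (corolla (Triangle.mk p₀ p₁ a)) 1 (corolla (Triangle.mk b q₁ q₂)))
        (graft (corolla (Triangle.mk p₀ p₁ (a * b))) 1 (corolla (Triangle.mk 1 q₁ q₂))) := by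
      intro a b
      by_cases hb : b = 1
      · rw [hb, mul_one]
        exact .refl _
      · exact .rel _ _ (.rule3 _ _ _ _ _ _ hb)
    exact (key p₂ q₀).trans _ _ _ (h ▸ (key r₂ r₀).symm _ _)

theorem isQuadratic_ncRelations : IsQuadratic (ncRelations K M) := by
  intro n
  refine Submodule.span_le.2 fun x hx => ?_
  obtain ⟨t, s, ht, hs, ht', hs', -, rfl⟩ := NCRelation.exists_trees K hx
  exact Submodule.sub_mem _ (Submodule.subset_span ⟨⟨t, ht⟩, ht', rfl⟩)
    (Submodule.subset_span ⟨⟨s, hs⟩, hs', rfl⟩)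

theorem NCRule.numLeaves {t s : BinaryTree (Triangle M)} (h : NCRule M t s) :
    t.numLeaves = 3 ∧ s.numLeaves = 3 := by
  cases h <;> exact ⟨rfl, rfl⟩

/-- The first family covers only products different from `1`. When the product is `1`, two relations
of the second family with the same right member are subtracted. -/
theorem sub_mem_ncRelations_left {p₀ p₁ p₂ q₀ q₁ q₂ r₀ r₁ : M} (h : p₁ * q₀ = r₁ * r₀) :
    treeElem K (graft (corolla (Triangle.mk p₀ p₁ p₂)) 0 (corolla (Triangle.mk q₀ q₁ q₂)))
        (numLeaves_comp_left _ _) -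
      treeElem K (graft (corolla (Triangle.mk p₀ r₁ p₂)) 0 (corolla (Triangle.mk r₀ q₁ q₂)))
        (numLeaves_comp_left _ _) ∈ ncRelations K M (1 + 1) := by
  rw [← comp_freeCorolla_left, ← comp_freeCorolla_left]
  by_cases h1 : r₁ * r₀ = 1
  · have e1 := Submodule.subset_span (R := K)
      (NCRelation.rel2 (K := K) p₀ p₁ p₂ q₀ q₁ q₂ 1 1 (h.trans h1) (one_mul 1))
    have e2 := Submodule.subset_span (R := K)
      (NCRelation.rel2 (K := K) p₀ r₁ p₂ r₀ q₁ q₂ 1 1 h1 (one_mul 1))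
    have := Submodule.sub_mem _ e1 e2
    rwa [sub_sub_sub_cancel_right] at this
  · exact Submodule.subset_span (.rel1 _ _ _ _ _ _ _ _ h h1)

theorem sub_mem_ncRelations_right {p₀ p₁ p₂ q₀ q₁ q₂ r₀ r₂ : M} (h : p₂ * q₀ = r₂ * r₀) :
    treeElem K (graft (corolla (Triangle.mk p₀ p₁ p₂)) 1 (corolla (Triangle.mk q₀ q₁ q₂)))
        (numLeaves_comp_right _ _) -
      treeElem K (graft (corolla (Triangle.mk p₀ p₁ r₂)) 1 (corolla (Triangle.mk r₀ q₁ q₂)))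
        (numLeaves_comp_right _ _) ∈ ncRelations K M (1 + 1) := by
  rw [← comp_freeCorolla_right, ← comp_freeCorolla_right]
  by_cases h1 : r₂ * r₀ = 1
  -- Both trees are right members of relations of the second family with the left member `(p₀; 1,
  -- q₂) ∘₁ (1; p₁, q₁)`, which cancels.
  · have e1 := Submodule.subset_span (R := K)
      (NCRelation.rel2 (K := K) p₀ 1 q₂ 1 p₁ q₁ q₀ p₂ (one_mul 1) (h.trans h1))
    have e2 := Submodule.subset_span (R := K)
      (NCRelation.rel2 (K := K) p₀ 1 q₂ 1 p₁ q₁ r₀ r₂ (one_mul 1) h1)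
    have := Submodule.sub_mem _ e2 e1
    rwa [sub_sub_sub_cancel_left] at this
  · exact Submodule.subset_span (.rel3 _ _ _ _ _ _ _ _ h h1)

theorem NCRule.treeCongr {t s : BinaryTree (Triangle M)} (h : NCRule M t s) :
    TreeCongr (ncRelations K M) t s := by
  intro n ht hs
  obtain rfl : n = 1 + 1 := by have := h.numLeaves; omega
  cases h with
  | rule1 p₀ p₁ p₂ q₀ q₁ q₂ h => exact sub_mem_ncRelations_left K (mul_one _).symm
  | rule2 p₀ p₁ p₂ q₀ q₁ q₂ h =>
    have := Submodule.subset_span (R := K)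
      (NCRelation.rel2 (K := K) p₀ p₁ p₂ q₀ q₁ q₂ 1 1 h (one_mul 1))
    rwa [comp_freeCorolla_left, comp_freeCorolla_right] at this
  | rule3 p₀ p₁ p₂ q₀ q₁ q₂ h => exact sub_mem_ncRelations_right K (mul_one _).symm

/-- The arity is carried along with the congruence because transitivity needs the intermediate tree
to lie in the same component. -/
theorem numLeaves_eq_and_treeCongr_of_eqvGen {t s : BinaryTree (Triangle M)}
    (h : Relation.EqvGen (NCRule M) t s) :
    t.numLeaves = s.numLeaves ∧ TreeCongr (ncRelations K M) t s := by
  induction h with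
  | rel t s h => exact ⟨h.numLeaves.1.trans h.numLeaves.2.symm, h.treeCongr K⟩
  | refl t => exact ⟨rfl, fun n _ _ => by rw [sub_self]; exact zero_mem _⟩
  | symm t s _ ih =>
    exact ⟨ih.1.symm, fun n ht hs => by rw [← neg_sub]; exact neg_mem (ih.2 n hs ht)⟩
  | trans t s r _ _ ih ih' =>
    refine ⟨ih.1.trans ih'.1, fun n ht hr => ?_⟩
    have hs := ih.1 ▸ ht
    rw [← sub_add_sub_cancel _ (treeElem K s hs)]
    exact add_mem (ih.2 n ht hs) (ih'.2 n hs hr)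

theorem inducedSpace_eq_ncRelations :
    RewriteRule.inducedSpace K (NCRule M) = ncRelations K M := by
  funext n
  refine le_antisymm (Submodule.span_le.2 ?_) (Submodule.span_le.2 fun x hx => ?_)
  · rintro _ ⟨t, s, h, rfl⟩
    exact (numLeaves_eq_and_treeCongr_of_eqvGen K h).2 n t.2 s.2
  · obtain ⟨t, s, ht, hs, -, -, h, rfl⟩ := NCRelation.exists_trees K hx
    exact Submodule.subset_span ⟨⟨t, ht⟩, ⟨s, hs⟩, h, rfl⟩

variable (M) in
/-- The operad ideal generated by the relations of `NC M`. -/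
noncomputable abbrev ncIdeal : (freeOperad K (Triangle M)).OperadIdeal :=
  NSOperad.OperadIdeal.generated (freeOperad K (Triangle M)) (ncRelations K M)

theorem ncRelations_le_ncIdeal (n : ℕ) : ncRelations K M n ≤ (ncIdeal K M).carrier n :=
  le_iInf fun I => I.2 n

theorem NCRule.treeCongr_ncIdeal {t s : BinaryTree (Triangle M)} (h : NCRule M t s)
    (a b c : BinaryTree (Triangle M)) :
    TreeCongr (ncIdeal K M).carrier (graft (graft (graft t 2 c) 1 b) 0 a)
      (graft (graft (graft s 2 c) 1 b) 0 a) :=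
  TreeCongr.graft_three _ (fun n ht hs => ncRelations_le_ncIdeal K n (h.treeCongr K n ht hs))
    h.numLeaves.1 h.numLeaves.2 a b c

theorem SyntaxTree.LocalStep.treeCongr {t s : BinaryTree (Triangle M)} (h : LocalStep t s) :
    TreeCongr (ncIdeal K M).carrier t s := by
  induction h with
  | absorb_left p₀ p₁ p₂ q₀ q₁ q₂ h a b c =>
    simpa [SyntaxTree.graft, corolla] using
      (NCRule.rule1 p₀ p₁ p₂ q₀ q₁ q₂ h).treeCongr_ncIdeal K a b c
  | rotate p₀ p₁ p₂ q₀ q₁ q₂ h a b c =>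
    simpa [SyntaxTree.graft, corolla] using
      (NCRule.rule2 p₀ p₁ p₂ q₀ q₁ q₂ h).treeCongr_ncIdeal K a b c
  | absorb_right p₀ p₁ p₂ q₀ q₁ q₂ h a b c =>
    simpa [SyntaxTree.graft, corolla] using
      (NCRule.rule3 p₀ p₁ p₂ q₀ q₁ q₂ h).treeCongr_ncIdeal K a b c
  | left g b h ih => exact ih.node_left _ h.numLeaves_eq g b
  | right g a h ih => exact ih.node_right _ h.numLeaves_eq g a

theorem treeCongr_of_reflTransGen {t s : BinaryTree (Triangle M)}
    (h : Relation.ReflTransGen LocalStep t s) : TreeCongr (ncIdeal K M).carrier t s := by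
  induction h with
  | refl => exact fun n _ _ => by rw [sub_self]; exact zero_mem _
  | @tail s r h h' ih =>
    intro n ht hr
    have hs := h'.numLeaves_eq.trans hr
    rw [← sub_add_sub_cancel _ (treeElem K s hs)]
    exact add_mem (ih n ht hs) (h'.treeCongr K n hs hr)

/-- Two trees with the same evaluation are congruent modulo the ideal of relations. -/
theorem treeCongr_of_evalLab_eq {t s : BinaryTree (Triangle M)} (h : evalLab t = evalLab s) :
    TreeCongr (ncIdeal K M).carrier t s := by
  intro n ht hs
  obtain ⟨r, h₁, h₂⟩ := exists_common_reduct (ht.trans hs.symm) h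
  have hr := (numLeaves_eq_of_reflTransGen h₁).symm.trans ht
  rw [← sub_sub_sub_cancel_right _ _ (treeElem K r hr)]
  exact sub_mem (treeCongr_of_reflTransGen K h₁ n ht hr) (treeCongr_of_reflTransGen K h₂ n hs hr)

end NCPresentation

/-! ### The kernel and the image of linear evaluation -/

section Evaluation

open SyntaxTree

variable (K : Type u) [Field K] {M : Type v} [MulOneClass M]

theorem freeOperad_induction {G : Type v} {n : ℕ} {P : (freeOperad K G).obj n → Prop}
    (zero : P 0) (add : ∀ x y, P x → P y → P (x + y))
    (smul_tree : ∀ (c : K) (t : BinaryTree G) (h : t.numLeaves = n + 1), P (c • treeElem K t h))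
    (x : (freeOperad K G).obj n) : P x := by
  refine Finsupp.induction_linear (motive := P) x zero add fun t c => ?_
  have : c • (Finsupp.single t 1 : (SynTree.setOperad G).obj n →₀ K) = Finsupp.single t c := by
    rw [Finsupp.smul_single, smul_eq_mul, mul_one]
  exact this ▸ smul_tree c t.1 t.2

theorem numLeaves_corolla {G : Type v} (g : G) : (corolla g).numLeaves = 1 + 1 := rfl

theorem eval_nil (h : (BinaryTree.nil : BinaryTree (Triangle M)).numLeaves = 0 + 1) :
    eval .nil h = Clique.one :=
  Clique.ext_lab fun x y _ _ _ => by rw [Clique.lab_size_one, Clique.lab_size_one]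

variable (M) in
/-- The linear evaluation of syntax trees on triangles as cliques. -/
noncomputable def evalLin (n : ℕ) :
    (freeOperad K (Triangle M)).obj n →ₗ[K] (cliqueOperad K M).obj n :=
  Finsupp.lmapDomain K K fun t : SynTree (Triangle M) n => eval t.1 t.2

theorem evalLin_treeElem {n : ℕ} (t : BinaryTree (Triangle M)) (h : t.numLeaves = n + 1) :
    evalLin K M n (treeElem K t h) = cliqueBasis K (eval t h) :=
  Finsupp.mapDomain_single

theorem cliqueOperad_comp_cliqueBasis {n m : ℕ} (i : Fin (n + 1)) (p : Clique M n)
    (q : Clique M m) :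
    (cliqueOperad K M).comp i (cliqueBasis K p) (cliqueBasis K q) =
      cliqueBasis K (Clique.comp i p q) :=
  ((Clique.setOperad M).linComp_single K i p q 1 1).trans (by rw [mul_one]; rfl)

theorem evalLin_comp {n m : ℕ} (i : Fin (n + 1)) (x : (freeOperad K (Triangle M)).obj n)
    (y : (freeOperad K (Triangle M)).obj m) :
    evalLin K M (n + m) ((freeOperad K (Triangle M)).comp i x y) =
      (cliqueOperad K M).comp i (evalLin K M n x) (evalLin K M m y) := by
  induction x using freeOperad_induction with
  | zero => simp
  | add x x' hx hx' => simp only [map_add, LinearMap.add_apply, hx, hx']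
  | smul_tree c t ht =>
    induction y using freeOperad_induction with
    | zero => simp
    | add y y' hy hy' => simp only [map_add, hy, hy']
    | smul_tree d s hs =>
      have h : (graft t i s).numLeaves = n + m + 1 := by
        have := numLeaves_graft t s i (by omega)
        omega
      simp only [map_smul, LinearMap.smul_apply, freeOperad_comp_treeElem K i ht hs h,
        evalLin_treeElem, eval_graft i ht hs h, cliqueOperad_comp_cliqueBasis]

theorem range_evalLin (n : ℕ) :
    LinearMap.range (evalLin K M n) = (ncSuboperad K M).carrier n := by
  apply le_antisymm
  · rintro _ ⟨x, rfl⟩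
    induction x using freeOperad_induction with
    | zero => rw [map_zero]; exact zero_mem _
    | add x y hx hy => rw [map_add]; exact add_mem hx hy
    | smul_tree c t h =>
      rw [map_smul, evalLin_treeElem]
      exact Submodule.smul_mem _ _ (Submodule.subset_span ⟨_, noncrossing_eval t h, rfl⟩)
  · refine Submodule.span_le.2 ?_
    rintro _ ⟨p, hp, rfl⟩
    obtain ⟨t, h, rfl⟩ := exists_eval_eq hp
    exact ⟨treeElem K t h, evalLin_treeElem K t h⟩

theorem evalLab_eq_of_eqvGen {t s : BinaryTree (Triangle M)}
    (h : Relation.EqvGen (NCRule M) t s) : evalLab t = evalLab s := by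
  induction h with
  | rel t s h =>
    cases h with
    | rule1 p₀ p₁ p₂ q₀ q₁ q₂ h =>
      exact (LocalStep.absorb_left p₀ p₁ p₂ q₀ q₁ q₂ h .nil .nil .nil).evalLab_eq
    | rule2 p₀ p₁ p₂ q₀ q₁ q₂ h =>
      exact (LocalStep.rotate p₀ p₁ p₂ q₀ q₁ q₂ h .nil .nil .nil).evalLab_eq
    | rule3 p₀ p₁ p₂ q₀ q₁ q₂ h =>
      exact (LocalStep.absorb_right p₀ p₁ p₂ q₀ q₁ q₂ h .nil .nil .nil).evalLab_eq
  | refl t => rfl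
  | symm t s _ ih => exact ih.symm
  | trans t s r _ _ ih ih' => exact ih.trans ih'

variable (M) in
/-- The kernel of the evaluation of syntax trees, as an operad ideal. -/
noncomputable def evalKer : (freeOperad K (Triangle M)).OperadIdeal where
  carrier n := LinearMap.ker (evalLin K M n)
  comp_mem_left i x y hy := by
    rw [LinearMap.mem_ker] at hy ⊢
    rw [evalLin_comp, hy, map_zero]
  comp_mem_right i x y hx := by
    rw [LinearMap.mem_ker] at hx ⊢
    rw [evalLin_comp, hx, map_zero, LinearMap.zero_apply]

/-- The kernel is itself an ideal containing the relations, and the generated ideal is the smallest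
one. -/
theorem ncIdeal_le_ker (n : ℕ) : (ncIdeal K M).carrier n ≤ LinearMap.ker (evalLin K M n) := by
  refine iInf_le (fun I : {I : (freeOperad K (Triangle M)).OperadIdeal //
    ∀ n, ncRelations K M n ≤ I.carrier n} => I.1.carrier n) ⟨evalKer K M, fun n => ?_⟩
  refine Submodule.span_le.2 fun x hx => ?_
  obtain ⟨t, s, ht, hs, -, -, h, rfl⟩ := NCRelation.exists_trees K hx
  refine LinearMap.mem_ker.2 ?_
  rw [map_sub, evalLin_treeElem, evalLin_treeElem,
    (eval_eq_iff ht hs).2 (evalLab_eq_of_eqvGen h), sub_self]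

open Classical in
/-- A tree whose evaluation is a given noncrossing clique, modulo the relations. -/
noncomputable def treeClass {n : ℕ} (p : Clique M n) :
    (freeOperad K (Triangle M)).obj n ⧸ (ncIdeal K M).carrier n :=
  if hp : p.Noncrossing then
    (ncIdeal K M).carrier n |>.mkQ
      (treeElem K (exists_eval_eq hp).choose (exists_eval_eq hp).choose_spec.choose)
  -- The value on crossing cliques is immaterial: no tree evaluates to one.
  else 0

/-- The class does not depend on the chosen tree, since all trees with the same value are congruent.
-/
theorem treeClass_eval {n : ℕ} (t : BinaryTree (Triangle M)) (h : t.numLeaves = n + 1) :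
    treeClass K (eval t h) = ((ncIdeal K M).carrier n).mkQ (treeElem K t h) := by
  have hp := noncrossing_eval t h
  rw [treeClass, dif_pos hp]
  refine (Submodule.Quotient.eq _).2 (treeCongr_of_evalLab_eq K ?_ n _ _)
  exact (eval_eq_iff _ h).1 (exists_eval_eq hp).choose_spec.choose_spec

variable (M) in
/-- The linear map sending a noncrossing clique to the class of the trees it evaluates. -/
noncomputable def treeClassLin (n : ℕ) : (cliqueOperad K M).obj n →ₗ[K]
    (freeOperad K (Triangle M)).obj n ⧸ (ncIdeal K M).carrier n :=
  Finsupp.linearCombination K fun p : Clique M n => treeClass K p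

theorem treeClassLin_cliqueBasis {n : ℕ} (p : Clique M n) :
    treeClassLin K M n (cliqueBasis K p) = treeClass K p :=
  (Finsupp.linearCombination_single K 1 p).trans (one_smul _ _)

/-- The projection to the quotient factors through evaluation, which puts the kernel of evaluation
inside the ideal. -/
theorem treeClassLin_evalLin {n : ℕ} (x : (freeOperad K (Triangle M)).obj n) :
    treeClassLin K M n (evalLin K M n x) = ((ncIdeal K M).carrier n).mkQ x := by
  induction x using freeOperad_induction with
  | zero => simp only [map_zero]
  | add x y hx hy => simp only [map_add, hx, hy]
  | smul_tree c t h =>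
    simp only [map_smul, evalLin_treeElem, treeClassLin_cliqueBasis, treeClass_eval]

/-- The kernel of the evaluation is the operad ideal generated by the relations. -/
theorem ncIdeal_eq_ker (n : ℕ) : (ncIdeal K M).carrier n = LinearMap.ker (evalLin K M n) := by
  refine le_antisymm (ncIdeal_le_ker K n) fun x hx => ?_
  have h := treeClassLin_evalLin K x
  rw [LinearMap.mem_ker.1 hx, map_zero] at h
  exact (Submodule.Quotient.mk_eq_zero _).1 h.symm

variable (M) in
/-- The presented operad is linearly isomorphic to `NC M` in each arity. -/
noncomputable def ncEquiv (n : ℕ) : (ncPresented K M).obj n ≃ₗ[K] (ncOperad K M).obj n :=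
  (Submodule.quotEquivOfEq _ _ (ncIdeal_eq_ker K n)).trans
    ((evalLin K M n).quotKerEquivRange.trans (LinearEquiv.ofEq _ _ (range_evalLin K n)))

theorem coe_ncEquiv_proj {n : ℕ} (x : (freeOperad K (Triangle M)).obj n) :
    ((ncSuboperad K M).carrier n).subtype (ncEquiv K M n ((ncIdeal K M).proj n x)) =
      evalLin K M n x :=
  rfl

variable (M) in
/-- The isomorphism between the presented operad and `NC M`. -/
noncomputable def ncIso : NSOperad.Iso (ncPresented K M) (ncOperad K M) where
  toEquiv := ncEquiv K M
  map_one := by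
    refine Subtype.ext ((coe_ncEquiv_proj K
      (treeElem K (.nil : BinaryTree (Triangle M)) rfl)).trans ?_)
    exact (evalLin_treeElem K .nil rfl).trans (congrArg (cliqueBasis K) (eval_nil rfl))
  map_comp {n m} i x y := by
    induction x using Submodule.Quotient.induction_on with | _ x
    induction y using Submodule.Quotient.induction_on with | _ y
    exact Subtype.ext (evalLin_comp K i x y)

theorem ncIso_generator (p : Triangle M) :
    (ncIso K M).toEquiv 1 (ncPresentedGenerator K p) = ncTriangle K p := by
  refine Subtype.ext ((coe_ncEquiv_proj K (treeElem K (corolla p) (numLeaves_corolla p))).trans ?_)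
  exact (evalLin_treeElem K (corolla p) _).trans (congrArg (cliqueBasis K) (eval_corolla p _))

/-! ### Generation by the triangles -/

/-- A suboperad containing the triangles contains the evaluation of every tree. -/
theorem cliqueBasis_eval_mem (P : (cliqueOperad K M).Suboperad)
    (hP : ∀ n, triangleSet K M n ⊆ P.carrier n) (t : BinaryTree (Triangle M)) {n : ℕ}
    (h : t.numLeaves = n + 1) : cliqueBasis K (eval t h) ∈ P.carrier n := by
  induction t generalizing n with
  | nil =>
    obtain rfl : n = 0 := by simpa using h.symm
    rw [eval_nil]
    exact P.one_mem
  | node g a b iha ihb =>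
    obtain ⟨k, hk⟩ := exists_numLeaves_eq a
    obtain ⟨m, hm⟩ := exists_numLeaves_eq b
    -- The sum is written in the order in which the two compositions, first with `b` and then with
    -- `a`, increase the arity, so that no transport between components is needed.
    obtain rfl : n = 1 + m + k := by simp only [BinaryTree.numLeaves] at h; omega
    have hb : (graft (corolla g) 1 b).numLeaves = 1 + m + 1 := by
      have := numLeaves_graft (corolla g) b 1 (by simp [corolla])
      simp only [corolla, BinaryTree.numLeaves] at this ⊢
      omega
    have ha : (graft (graft (corolla g) 1 b) 0 a).numLeaves = 1 + m + k + 1 := by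
      rw [graft_eq_node]; exact h
    have e : eval (.node g a b) h =
        Clique.comp (0 : Fin (1 + m + 1)) (Clique.comp (1 : Fin (1 + 1)) g (eval b hm))
          (eval a hk) := by
      have e₁ := eval_graft (1 : Fin (1 + 1)) (numLeaves_corolla g) hm hb
      have e₂ := eval_graft (0 : Fin (1 + m + 1)) hb hk ha
      rw [eval_corolla] at e₁
      rw [← e₁]
      refine Eq.trans ((eval_eq_iff _ _).2 ?_) e₂
      rw [← graft_eq_node]
      rfl
    rw [e, ← cliqueOperad_comp_cliqueBasis, ← cliqueOperad_comp_cliqueBasis]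
    exact P.comp_mem _ (P.comp_mem _ (hP 1 ⟨rfl, g, rfl⟩) (ihb hm)) (iha hk)

theorem generated_triangleSet :
    NSOperad.Suboperad.generated (cliqueOperad K M) (triangleSet K M) = ncSuboperad K M := by
  refine NSOperad.Suboperad.ext (funext fun n => le_antisymm ?_ ?_)
  · refine iInf_le (fun P : {P : (cliqueOperad K M).Suboperad //
      ∀ n, triangleSet K M n ⊆ P.carrier n} => P.1.carrier n) ⟨ncSuboperad K M, ?_⟩
    rintro n _ ⟨rfl, p, rfl⟩
    exact Submodule.subset_span ⟨p, p.noncrossing_of_size_le_two le_rfl, rfl⟩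
  · refine Submodule.span_le.2 ?_
    rintro _ ⟨p, hp, rfl⟩
    obtain ⟨t, h, rfl⟩ := exists_eval_eq hp
    exact (Submodule.mem_iInf _).2 fun P => cliqueBasis_eval_mem K P.1 P.2 t h

end Evaluation

/-! ### Counting normal forms and noncrossing cliques -/

section Counting

open SyntaxTree

variable (K : Type u) [Field K] {M : Type v} [MulOneClass M]

instance Arc.finite (n : ℕ) : Finite (Arc n) := by
  refine Finite.of_injective (β := Fin (n + 3) × Fin (n + 3))
    (fun a => (⟨a.1.1, by have := a.2; omega⟩, ⟨a.1.2, by have := a.2; omega⟩)) ?_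
  intro a b h
  simp only [Prod.mk.injEq, Fin.mk.injEq] at h
  exact Subtype.ext (Prod.ext h.1 h.2)

instance Clique.finite [Finite M] (n : ℕ) : Finite (Clique M n) :=
  Finite.of_injective Clique.label fun _ _ h => Clique.ext h

/-- The evaluation of the normal forms of arity `n + 1`. -/
def evalNormalForm (n : ℕ) (t : {t : BinaryTree (Triangle M) //
    t.numLeaves = n + 1 ∧ RewriteRule.IsNormalForm (NCRule M) t}) :
    {p : Clique M n // p.Noncrossing} :=
  ⟨eval t.1 t.2.1, noncrossing_eval _ _⟩

/-- The normal forms are in bijection with the noncrossing cliques. -/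
theorem evalNormalForm_bijective (n : ℕ) :
    Function.Bijective (evalNormalForm (M := M) n) := by
  constructor
  · rintro ⟨t, ht, ht'⟩ ⟨s, hs, hs'⟩ h
    refine Subtype.ext (evalLab_injective_of_normalForm (isNormalForm_iff.1 ht')
      (isNormalForm_iff.1 hs') (ht.trans hs.symm) ?_)
    exact (eval_eq_iff ht hs).1 (congrArg Subtype.val h)
  · rintro ⟨p, hp⟩
    obtain ⟨t, ht, rfl⟩ := exists_eval_eq hp
    obtain ⟨s, hs, hs'⟩ := exists_normalForm t
    have hn := (numLeaves_eq_of_reflTransGen hs).symm.trans ht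
    exact ⟨⟨s, hn, hs'⟩,
      Subtype.ext ((eval_eq_iff hn ht).2 (evalLab_eq_of_reflTransGen hs).symm)⟩

theorem finite_normalForms [Finite M] (n : ℕ) : Finite {t : BinaryTree (Triangle M) //
    t.numLeaves = n ∧ RewriteRule.IsNormalForm (NCRule M) t} := by
  cases n with
  | zero =>
    have : IsEmpty {t : BinaryTree (Triangle M) //
        t.numLeaves = 0 ∧ RewriteRule.IsNormalForm (NCRule M) t} :=
      ⟨fun t => (numLeaves_pos t.1).ne' t.2.1⟩
    infer_instance
  | succ n => exact Finite.of_injective _ (evalNormalForm_bijective n).injective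

theorem ncSuboperad_carrier_eq (n : ℕ) : (ncSuboperad K M).carrier n =
    Submodule.span K (Set.range fun p : {p : Clique M n // p.Noncrossing} =>
      cliqueBasis K p.1) := by
  refine congrArg (Submodule.span K) (Set.ext fun x => ?_)
  constructor
  · rintro ⟨p, hp, rfl⟩
    exact ⟨⟨p, hp⟩, rfl⟩
  · rintro ⟨p, rfl⟩
    exact ⟨p.1, p.2, rfl⟩

theorem linearIndependent_cliqueBasis (n : ℕ) :
    LinearIndependent K fun p : {p : Clique M n // p.Noncrossing} => cliqueBasis K p.1 :=
  (Finsupp.linearIndependent_single_one K (Clique M n)).comp _ Subtype.val_injective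

theorem finite_ncOperad [Finite M] (n : ℕ) : Module.Finite K ((ncOperad K M).obj n) := by
  change Module.Finite K ((ncSuboperad K M).carrier n)
  rw [ncSuboperad_carrier_eq]
  exact Module.Finite.span_of_finite K (Set.finite_range _)

theorem finrank_ncOperad [Finite M] (n : ℕ) :
    Module.finrank K ((ncOperad K M).obj n) = Nat.card {p : Clique M n // p.Noncrossing} := by
  change Module.finrank K ((ncSuboperad K M).carrier n) = _
  have := Fintype.ofFinite {p : Clique M n // p.Noncrossing}
  rw [ncSuboperad_carrier_eq, finrank_span_eq_card (linearIndependent_cliqueBasis K n),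
    Nat.card_eq_fintype_card]

/-- Both coefficients count the noncrossing cliques, through the bijection with normal forms and
through the basis of `ncOperad`. In arity 0 both vanish, as every tree has a leaf. -/
theorem normalFormSeries_eq_hilbertSeries [Finite M] :
    RewriteRule.normalFormSeries (NCRule M) = (ncOperad K M).hilbertSeries := by
  ext n
  rw [RewriteRule.normalFormSeries, NSOperad.hilbertSeries, PowerSeries.coeff_mk,
    PowerSeries.coeff_mk]
  cases n with
  | zero =>
    have : IsEmpty {t : BinaryTree (Triangle M) //
        t.numLeaves = 0 ∧ RewriteRule.IsNormalForm (NCRule M) t} :=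
      ⟨fun t => (numLeaves_pos t.1).ne' t.2.1⟩
    rw [if_pos rfl, Nat.card_of_isEmpty]
  | succ n =>
    rw [if_neg (Nat.succ_ne_zero n), Nat.add_sub_cancel, finrank_ncOperad]
    exact Nat.card_eq_of_bijective _ (evalNormalForm_bijective n)

end Counting

/-- Presentation of the operad `NC M` of noncrossing `M`-cliques of a finite unitary magma `M`. -/
theorem mainTheorem2 (K : Type*) [Field K] [CharZero K] (M : Type*) [MulOneClass M] [Finite M] :
    -- `NC M` is the suboperad of `C M` generated by the `M`-triangles
    NSOperad.Suboperad.generated (cliqueOperad K M) (triangleSet K M) = ncSuboperad K M ∧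
    -- `NC M` admits the binary and quadratic presentation by the triangles and the relations
    IsQuadratic (ncRelations K M) ∧
    (∃ φ : NSOperad.Iso (ncPresented K M) (ncOperad K M),
      ∀ p : Triangle M, φ.toEquiv 1 (ncPresentedGenerator K p) = ncTriangle K p) ∧
    -- the rewrite rule is a convergent orientation of the relations
    RewriteRule.inducedSpace K (NCRule M) = ncRelations K M ∧
    RewriteRule.Convergent (NCRule M) ∧
    -- its normal forms are counted by the Hilbert series of `NC M`
    (∀ n, Module.Finite K ((ncOperad K M).obj n)) ∧
    (∀ n, Finite {t : BinaryTree (Triangle M) //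
      t.numLeaves = n ∧ RewriteRule.IsNormalForm (NCRule M) t}) ∧
    RewriteRule.normalFormSeries (NCRule M) = (ncOperad K M).hilbertSeries := by
  exact ⟨generated_triangleSet K, isQuadratic_ncRelations K, ⟨ncIso K M, ncIso_generator K⟩,
    inducedSpace_eq_ncRelations K, ⟨SyntaxTree.terminating, SyntaxTree.confluent⟩,
    finite_ncOperad K, finite_normalForms, normalFormSeries_eq_hilbertSeries K⟩
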